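/- Let $n\ge 2$. For each $k=1,\dots,n-1$ let $i_k\in\{0,1,\dots,k\}$ and $i'_k\in\{1,\dots,k+1\}$ be integers with $i_k<i'_k$, and fix integers $\lambda_1>\lambda_2>\dots>\lambda_n$. Let $\mathcal B$ be the set of all integer tableaux $L=(l_{kj})_{1\le j\le k\le n}$ with top row $l_{nj}=\lambda_j$ $(1\le j\le n)$ such that, for all $1\le j\le k\le n-1$, $$l_{k+1,j-1}\ge l_{kj}>l_{k+1,j}\quad\text{if } j\le i_k,$$ $$l_{k+1,j}\ge l_{kj}>l_{k+1,j+1}\quad\text{if } i_k<j<i'_k,$$ $$l_{k+1,j+1}\ge l_{kj}>l_{k+1,j+2}\quad\text{if } j\ge i'_k,$$ where inequalities involving the non-existent entries $l_{k+1,0}$ or $l_{k+1,k+2}$ are omitted. (All rows of such a tableau are strictly decreasing.) Let $H\{i_k,i'_k\}$ be the complex vector space with basis $\{T(L): L\in\mathcal B\}$, put $T(L)=0$ for $L\notin\mathcal B$, and let $\delta^{kr}$ be the tableau whose only nonzero entry is a $1$ at place $(k,r)$. **Theorem I.** There is a $\mathfrak{gl}_n(\mathbb C)$-module structure on $H\{i_k,i'_k\}$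 such that for all $L\in\mathcal B$ the Gelfand–Tsetlin formulas $$E_{k,k+1}T(L)=-\sum_{r=1}^{k}\frac{\prod_{j=1}^{k+1}(l_{kr}-l_{k+1,j})}{\prod_{1\le j\le k,\,j\ne r}(l_{kr}-l_{kj})}\,T(L+\delta^{kr})\quad(1\le k\le n-1),$$ $$E_{k+1,k}T(L)=\sum_{r=1}^{k}\frac{\prod_{j=1}^{k-1}(l_{kr}-l_{k-1,j})}{\prod_{1\le j\le k,\,j\ne r}(l_{kr}-l_{kj})}\,T(L-\delta^{kr})\quad(1\le k\le n-1),$$ $$E_{kk}T(L)=\Bigl(k-1+\sum_{r=1}^{k}l_{kr}-\sum_{r=1}^{k-1}l_{k-1,r}\Bigr)T(L)\quad(1\le k\le n)$$ hold if and only if the Lemire–Patera condition is satisfied: $$i_{k-1},\ i'_{k-1}\in\{0,\ i_k,\ i'_k-1,\ k\}\qquad\text{for every } k=2,\dots,n-1.$$ -/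

import Mathlib

namespace GelfandGraev

/-- A tableau of height `n` with integer entries `L k j`, for `1 ≤ j ≤ k ≤ n`
(`k` is the row, `j` the position in the row, both counted from `1`, and row `n` is the top row).
Outside this triangle the array is zero, so that it is determined by its entries. -/
def IsTableau (n : ℕ) (L : ℕ → ℕ → ℤ) : Prop :=
  ∀ k j, ¬ (1 ≤ j ∧ j ≤ k ∧ k ≤ n) → L k j = 0

/-- Row `n` of `L` is the given row `top 0, …, top (n - 1)`. -/
def HasTopRow (n : ℕ) (top : Fin n → ℤ) (L : ℕ → ℕ → ℤ) : Prop :=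
  ∀ j : Fin n, L n (j.val + 1) = top j

/-- The pairs `{i k, i' k}`, `1 ≤ k ≤ n - 1`, of a Gelfand-Graev continuation. -/
def IsIndexSystem (n : ℕ) (i i' : ℕ → ℕ) : Prop :=
  ∀ k, 1 ≤ k → k ≤ n - 1 → i k ≤ k ∧ 1 ≤ i' k ∧ i' k ≤ k + 1 ∧ i k < i' k

/-- The Gelfand-Graev inequalities. An inequality that would involve a position `0` or `k + 2` of
row `k + 1`, which do not exist, is absent. -/
structure SatisfiesGG (n : ℕ) (i i' : ℕ → ℕ) (L : ℕ → ℕ → ℤ) : Prop where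
  top : ∀ j, 1 ≤ j → j + 1 ≤ n → L n (j + 1) < L n j
  left_le : ∀ k j, 1 ≤ k → k ≤ n - 1 → 2 ≤ j → j ≤ k → j ≤ i k →
    L k j ≤ L (k + 1) (j - 1)
  left_lt : ∀ k j, 1 ≤ k → k ≤ n - 1 → 1 ≤ j → j ≤ k → j ≤ i k →
    L (k + 1) j < L k j
  mid_le : ∀ k j, 1 ≤ k → k ≤ n - 1 → 1 ≤ j → j ≤ k → i k < j → j < i' k →
    L k j ≤ L (k + 1) j
  mid_lt : ∀ k j, 1 ≤ k → k ≤ n - 1 → 1 ≤ j → j ≤ k → i k < j → j < i' k →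
    L (k + 1) (j + 1) < L k j
  right_le : ∀ k j, 1 ≤ k → k ≤ n - 1 → 1 ≤ j → j ≤ k → i' k ≤ j →
    L k j ≤ L (k + 1) (j + 1)
  right_lt : ∀ k j, 1 ≤ k → k ≤ n - 1 → 1 ≤ j → j + 1 ≤ k → i' k ≤ j →
    L (k + 1) (j + 2) < L k j

/-- The rows of a tableau that satisfies the Gelfand-Graev inequalities are strictly decreasing;
in particular no denominator in the Gelfand-Tsetlin formulas below vanishes. -/
theorem SatisfiesGG.row_lt {n : ℕ} {i i' : ℕ → ℕ} {L : ℕ → ℕ → ℤ}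
    (hi : IsIndexSystem n i i') (h : SatisfiesGG n i i' L) :
    ∀ k j, 1 ≤ k → k ≤ n → 1 ≤ j → j + 1 ≤ k → L k (j + 1) < L k j := by
  suffices H : ∀ d k j, k + d = n → 1 ≤ k → 1 ≤ j → j + 1 ≤ k → L k (j + 1) < L k j by
    intro k j h1 h2 h3 h4
    exact H (n - k) k j (by omega) h1 h3 h4
  intro d
  induction d with
  | zero =>
    intro k j h1 h2 h3 h4
    obtain rfl : k = n := by omega
    exact h.top j h3 h4
  | succ d ih =>
    intro k j h1 h2 h3 h4
    have hk : k ≤ n - 1 := by omega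
    have a1 := ih (k + 1) j (by omega) (by omega) (by omega) (by omega)
    have a2 := ih (k + 1) (j + 1) (by omega) (by omega) (by omega) (by omega)
    have b := hi k h2 hk
    have c1 := h.left_le k (j + 1) h2 hk (by omega) h4
    have c2 := h.left_lt k j h2 hk h3 (by omega)
    have c3 := h.mid_le k (j + 1) h2 hk (by omega) h4
    have c4 := h.mid_lt k j h2 hk h3 (by omega)
    have c5 := h.right_le k (j + 1) h2 hk (by omega) h4
    have c6 := h.right_lt k j h2 hk h3 h4
    simp only [Nat.add_sub_cancel] at c1
    by_cases p1 : j ≤ i k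
    · have := c2 p1
      by_cases p2 : j + 1 ≤ i k
      · have := c1 p2
        omega
      · by_cases p3 : j + 1 < i' k
        · have := c3 (by omega) p3
          omega
        · have := c5 (by omega)
          have e : j + 1 + 1 = j + 2 := rfl
          rw [e] at *
          omega
    · by_cases p2 : j < i' k
      · have := c4 (by omega) p2
        by_cases p3 : j + 1 < i' k
        · have := c3 (by omega) p3
          omega
        · have := c5 (by omega)
          have e : j + 1 + 1 = j + 2 := rfl
          rw [e] at *
          omega
      · have := c6 (by omega)
        have := c5 (by omega)
        have e : j + 1 + 1 = j + 2 := rfl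
        rw [e] at *
        omega

/-- The labels of the basis of `H{i_k, i_k'}`: all integer tableaux with the fixed top row `top`
that satisfy the Gelfand-Graev inequalities. -/
def basisTableaux (n : ℕ) (i i' : ℕ → ℕ) (top : Fin n → ℤ) : Set (ℕ → ℕ → ℤ) :=
  {L | IsTableau n L ∧ HasTopRow n top L ∧ SatisfiesGG n i i' L}

/-- The complex vector space `H{i_k, i_k'}` with the basis `T(L)`, `L ∈ basisTableaux`. -/
abbrev H (n : ℕ) (i i' : ℕ → ℕ) (top : Fin n → ℤ) : Type :=
  (basisTableaux n i i' top) →₀ ℂ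

open Classical in
/-- The vector `T(L)`: a basis vector if `L` labels one, and zero otherwise. -/
noncomputable def T (n : ℕ) (i i' : ℕ → ℕ) (top : Fin n → ℤ) (L : ℕ → ℕ → ℤ) :
    H n i i' top :=
  if h : L ∈ basisTableaux n i i' top then Finsupp.single ⟨L, h⟩ 1 else 0

/-- The array with the entry `1` in row `k`, position `r`, and zeros elsewhere. -/
def delta (k r : ℕ) : ℕ → ℕ → ℤ :=
  fun s t => if s = k ∧ t = r then 1 else 0

/-- The coefficient of `T(L + δ^{kr})` in `E_{k,k+1} T(L)`. -/
noncomputable def eCoeff (k r : ℕ) (L : ℕ → ℕ → ℤ) : ℂ :=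
  -((∏ j ∈ Finset.Icc 1 (k + 1), ((L k r : ℂ) - (L (k + 1) j : ℂ))) /
    (∏ j ∈ (Finset.Icc 1 k).erase r, ((L k r : ℂ) - (L k j : ℂ))))

/-- The coefficient of `T(L - δ^{kr})` in `E_{k+1,k} T(L)`. -/
noncomputable def fCoeff (k r : ℕ) (L : ℕ → ℕ → ℤ) : ℂ :=
  (∏ j ∈ Finset.Icc 1 (k - 1), ((L k r : ℂ) - (L (k - 1) j : ℂ))) /
    (∏ j ∈ (Finset.Icc 1 k).erase r, ((L k r : ℂ) - (L k j : ℂ)))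

/-- The eigenvalue of `E_{kk}` on `T(L)`. -/
noncomputable def weight (k : ℕ) (L : ℕ → ℕ → ℤ) : ℂ :=
  (k : ℂ) - 1 + ∑ j ∈ Finset.Icc 1 k, (L k j : ℂ) - ∑ j ∈ Finset.Icc 1 (k - 1), (L (k - 1) j : ℂ)

/-- The elementary matrix `E_{ab}`, with rows and columns counted from `1`. -/
def E (n a b : ℕ) : Matrix (Fin n) (Fin n) ℂ :=
  Matrix.of fun p q => if p.val + 1 = a ∧ q.val + 1 = b then 1 else 0

-- The bracket of matrices and of endomorphisms is the commutator.
attribute [local instance 100] LieRing.ofAssociativeRing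

/-- The representation `ρ` of `gl_n` on `H{i_k, i_k'}` is given on the generators by the
Gelfand-Tsetlin formulas. -/
structure IsGelfandTsetlinAction (n : ℕ) (i i' : ℕ → ℕ) (top : Fin n → ℤ)
    (ρ : Matrix (Fin n) (Fin n) ℂ →ₗ⁅ℂ⁆ Module.End ℂ (H n i i' top)) : Prop where
  raising : ∀ L ∈ basisTableaux n i i' top, ∀ k, 1 ≤ k → k ≤ n - 1 →
    ρ (E n k (k + 1)) (T n i i' top L) =
      ∑ r ∈ Finset.Icc 1 k, eCoeff k r L • T n i i' top (L + delta k r)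
  lowering : ∀ L ∈ basisTableaux n i i' top, ∀ k, 1 ≤ k → k ≤ n - 1 →
    ρ (E n (k + 1) k) (T n i i' top L) =
      ∑ r ∈ Finset.Icc 1 k, fCoeff k r L • T n i i' top (L - delta k r)
  diagonal : ∀ L ∈ basisTableaux n i i' top, ∀ k, 1 ≤ k → k ≤ n →
    ρ (E n k k) (T n i i' top L) = weight k L • T n i i' top L

/-- The Gelfand-Tsetlin formulas make `H{i_k, i_k'}` a `gl_n`-module. -/
def DefinesModule (n : ℕ) (i i' : ℕ → ℕ) (top : Fin n → ℤ) : Prop :=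
  ∃ ρ : Matrix (Fin n) (Fin n) ℂ →ₗ⁅ℂ⁆ Module.End ℂ (H n i i' top),
    IsGelfandTsetlinAction n i i' top ρ

/-- The Lemire-Patera condition on the index pairs. -/
def LemirePatera (n : ℕ) (i i' : ℕ → ℕ) : Prop :=
  ∀ k, 2 ≤ k → k ≤ n - 1 →
    i (k - 1) ∈ ({0, i k, i' k - 1, k} : Set ℕ) ∧ i' (k - 1) ∈ ({0, i k, i' k - 1, k} : Set ℕ)

end GelfandGraev

/-! The inequalities say that `l_{kj}` lies below exactly the first `slot k j` entries of row `k +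
1` (`mem_basisTableaux_iff`). A row has one entry in each interval cut out by the row above, except
for two intervals, numbered `i_k` and `i'_k`, which stay empty.

All operators are first defined on the span of all integer arrays, where a quotient with zero
denominator counts as `0`, and are then compressed to the span of the basis tableaux. A step that
would break an inequality `l_{kj} ≤ l_{k+1,m}` has coefficient zero (`linkLE_shift`), so the set of
valid inequalities can only grow. The basis tableaux all have the same set, hence they are convex
for this preorder and compression respects products (`trunc_mul`). Every relation may thus be
checked coefficient by coefficient between two basis tableaux.

Most of the Chevalley-Serre relations are identities of rational functions. Two kinds need care when
a row contains values `x` and `x + 1`. In the Serre relations a denominator can vanish when two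
entries of a row move together. In `[E_{k,k+1}, E_{k+1,k}]` the diagonal part is a sum of residues
of one rational function: the sum over all poles is the expected weight difference (`sum_residue`),
but the residues at the values `x` of row `k` with `x + 1` in the same row, the double poles, do not
occur in the commutator (`sum_coef_mul_coef`).

Sufficiency: positions `s`, `s + 1` of row `k` can hold adjacent values only if `s ≠ i_k` and `s + 1
≠ i'_k`. The Lemire-Patera condition then gives row `k - 1` an entry between them
(`LemirePatera.exists_of_adjacent`), namely `x + 1`. This kills the residue at `x` and prevents the
joint moves (`LemirePatera.gap`). The Serre presentation turns the generators into a representation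
(`ChevalleyRelations.matrixRelations`).

Necessity: in a module the residues at the double poles must sum to zero on every basis tableau. If
the condition fails, tableaux exist with adjacent values around an empty interval, and their
residues contradict this (`DefinesModule.false_of_slot_empty`). -/

namespace GelfandGraev

/-! ### The Serre presentation of `gl_n`. -/

section Chevalley

set_option linter.unusedSectionVars false

variable {A : Type*} [LieRing A] [LieAlgebra ℂ A]

/-- The Kronecker symbol. -/
def kron (a b : ℕ) : ℂ := if a = b then 1 else 0

@[simp] theorem kron_self (a : ℕ) : kron a a = 1 := if_pos rfl

theorem kron_of_ne {a b : ℕ} (h : a ≠ b) : kron a b = 0 := if_neg h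

theorem kron_comm (a b : ℕ) : kron a b = kron b a := by
  unfold kron; simp only [eq_comm]

/-- The Chevalley-Serre relations of `gl_n`. -/
structure ChevalleyRelations (n : ℕ) (h e f : ℕ → A) : Prop where
  hh : ∀ a b, 1 ≤ a → a ≤ n → 1 ≤ b → b ≤ n → ⁅h a, h b⁆ = 0
  he : ∀ a k, 1 ≤ a → a ≤ n → 1 ≤ k → k < n → ⁅h a, e k⁆ = (kron a k - kron a (k + 1)) • e k
  hf : ∀ a k, 1 ≤ a → a ≤ n → 1 ≤ k → k < n → ⁅h a, f k⁆ = (kron a (k + 1) - kron a k) • f k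
  ef : ∀ k, 1 ≤ k → k < n → ⁅e k, f k⁆ = h k - h (k + 1)
  ef_ne : ∀ k l, 1 ≤ k → k < n → 1 ≤ l → l < n → k ≠ l → ⁅e k, f l⁆ = 0
  ee : ∀ k l, 1 ≤ k → k + 2 ≤ l → l < n → ⁅e k, e l⁆ = 0
  ff : ∀ k l, 1 ≤ k → k + 2 ≤ l → l < n → ⁅f k, f l⁆ = 0
  eee_left : ∀ k, 1 ≤ k → k + 1 < n → ⁅e k, ⁅e k, e (k + 1)⁆⁆ = 0
  eee_right : ∀ k, 1 ≤ k → k + 1 < n → ⁅⁅e k, e (k + 1)⁆, e (k + 1)⁆ = 0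
  fff_left : ∀ k, 1 ≤ k → k + 1 < n → ⁅f k, ⁅f k, f (k + 1)⁆⁆ = 0
  fff_right : ∀ k, 1 ≤ k → k + 1 < n → ⁅⁅f k, f (k + 1)⁆, f (k + 1)⁆ = 0

/-- The Chevalley involution. -/
theorem ChevalleyRelations.involution {n : ℕ} {h e f : ℕ → A} (R : ChevalleyRelations n h e f) :
    ChevalleyRelations n (-h) (-f) (-e) where
  hh a b h1 h2 h3 h4 := by simp [R.hh a b h1 h2 h3 h4]
  he a k h1 h2 h3 h4 := by
    simp only [Pi.neg_apply, neg_lie, lie_neg, neg_neg, R.hf a k h1 h2 h3 h4]; module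
  hf a k h1 h2 h3 h4 := by
    simp only [Pi.neg_apply, neg_lie, lie_neg, neg_neg, R.he a k h1 h2 h3 h4]; module
  ef k h1 h2 := by
    simp only [Pi.neg_apply, neg_lie, lie_neg, neg_neg]
    rw [← lie_skew, R.ef k h1 h2]; abel
  ef_ne k l h1 h2 h3 h4 h5 := by
    simp only [Pi.neg_apply, neg_lie, lie_neg, neg_neg]
    rw [← lie_skew, R.ef_ne l k h3 h4 h1 h2 h5.symm, neg_zero]
  ee k l h1 h2 h3 := by simp [R.ff k l h1 h2 h3]
  ff k l h1 h2 h3 := by simp [R.ee k l h1 h2 h3]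
  eee_left k h1 h2 := by simp [R.fff_left k h1 h2]
  eee_right k h1 h2 := by simp [R.fff_right k h1 h2]
  fff_left k h1 h2 := by simp [R.eee_left k h1 h2]
  fff_right k h1 h2 := by simp [R.eee_right k h1 h2]

/-- The images of the elementary matrices on and above the diagonal. -/
def rootUp (h e : ℕ → A) (a : ℕ) : ℕ → A
  | 0 => h a
  | d + 1 => ⁅rootUp h e a d, e (a + d)⁆

/-- The images of the elementary matrices below the diagonal. -/
def rootDown (h f : ℕ → A) (a : ℕ) : ℕ → A
  | 0 => h a
  | d + 1 => ⁅f (a + d), rootDown h f a d⁆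

/-- The image of the elementary matrix `E_{ab}`, built from Chevalley generators. -/
def root (h e f : ℕ → A) (a b : ℕ) : A :=
  if a ≤ b then rootUp h e a (b - a) else rootDown h f b (a - b)

variable {h e f : ℕ → A}

theorem root_self (a : ℕ) : root h e f a a = h a := by
  simp [root, rootUp]

theorem root_up {a b : ℕ} (hab : a ≤ b) : root h e f a (b + 1) = ⁅root h e f a b, e b⁆ := by
  obtain ⟨d, rfl⟩ := Nat.exists_eq_add_of_le hab
  have e1 : a + d + 1 - a = d + 1 := by omega
  simp only [root, if_pos hab, if_pos (show a ≤ a + d + 1 by omega), e1, rootUp,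
    Nat.add_sub_cancel_left]

theorem root_down {a b : ℕ} (hab : b ≤ a) : root h e f (a + 1) b = ⁅f a, root h e f a b⁆ := by
  obtain ⟨d, rfl⟩ := Nat.exists_eq_add_of_le hab
  have e1 : b + d + 1 - b = d + 1 := by omega
  rw [root, if_neg (by omega), e1, rootDown]
  congr 1
  rcases Nat.eq_zero_or_pos d with rfl | hd
  · simp [root, rootUp, rootDown]
  · rw [root, if_neg (by omega), Nat.add_sub_cancel_left]

/-- On elementary matrices the Chevalley involution is `X ↦ -Xᵀ`. It turns every statement about the
last column into one about the last row. -/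
theorem root_involution (a b : ℕ) : root (-h) (-f) (-e) a b = -root h e f b a := by
  rcases le_total a b with hab | hab
  · induction b, hab using Nat.le_induction with
    | base => simp [root_self]
    | succ b hab ih =>
      rw [root_up hab, ih, root_down hab, ← lie_skew]; simp
  · induction a, hab using Nat.le_induction with
    | base => simp [root_self]
    | succ a hab ih =>
      rw [root_down hab, ih, root_up hab, ← lie_skew]; simp

theorem lie_lie_eq_zero {x y z : A} (h1 : ⁅x, z⁆ = 0) (h2 : ⁅y, z⁆ = 0) : ⁅⁅x, y⁆, z⁆ = 0 := by
  rw [lie_lie, h1, h2, lie_zero, lie_zero, sub_zero]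

/-- An element commuting with the generators of `gl_m` commutes with all of `gl_m`. -/
theorem root_lie_eq_zero {m : ℕ} {z : A} (hh : ∀ a, 1 ≤ a → a ≤ m → ⁅h a, z⁆ = 0)
    (he : ∀ k, 1 ≤ k → k < m → ⁅e k, z⁆ = 0) (hf : ∀ k, 1 ≤ k → k < m → ⁅f k, z⁆ = 0)
    {a b : ℕ} (ha : 1 ≤ a) (ha' : a ≤ m) (hb : 1 ≤ b) (hb' : b ≤ m) :
    ⁅root h e f a b, z⁆ = 0 := by
  rcases le_total a b with hab | hab
  · induction b, hab using Nat.le_induction with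
    | base => rw [root_self]; exact hh a ha ha'
    | succ b hab ih =>
      rw [root_up hab]
      exact lie_lie_eq_zero (ih (by omega) (by omega)) (he b (by omega) (by omega))
  · induction a, hab using Nat.le_induction with
    | base => rw [root_self]; exact hh b hb hb'
    | succ a hab ih =>
      rw [root_down hab]
      exact lie_lie_eq_zero (hf a (by omega) (by omega)) (ih (by omega) (by omega))

/-- The relations of `gl_m`. -/
def MatrixRelations (m : ℕ) (X : ℕ → ℕ → A) : Prop :=
  ∀ a b c d, 1 ≤ a → a ≤ m → 1 ≤ b → b ≤ m → 1 ≤ c → c ≤ m → 1 ≤ d → d ≤ m →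
    ⁅X a b, X c d⁆ = kron b c • X a d - kron d a • X c b

theorem MatrixRelations.involution {m : ℕ} (G : MatrixRelations m (root h e f)) :
    MatrixRelations m (root (-h) (-f) (-e)) := by
  intro a b c d a1 a2 b1 b2 c1 c2 d1 d2
  simp only [root_involution, neg_lie, lie_neg, neg_neg]
  rw [G b a d c b1 b2 a1 a2 d1 d2 c1 c2, kron_comm a d, kron_comm c b]
  module

namespace ChevalleyRelations

variable {n : ℕ} (R : ChevalleyRelations n h e f)
include R

theorem root_succ {m : ℕ} (h1 : 1 ≤ m) (h2 : m < n) : root h e f m (m + 1) = e m := by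
  rw [root_up le_rfl, root_self, R.he m m h1 h2.le h1 h2, kron_self, kron_of_ne (by omega)]
  simp

theorem root_pred {m : ℕ} (h1 : 1 ≤ m) (h2 : m < n) : root h e f (m + 1) m = f m := by
  rw [root_down le_rfl, root_self, ← lie_skew, R.hf m m h1 h2.le h1 h2, kron_self,
    kron_of_ne (by omega)]
  simp

/-- For `a ≤ b` the element lies in `gl_b` with `b < m`, whose generators commute with `e m`. For `a
≥ b` the value `a = m` is allowed and `h m` does not commute with `e m`, so the element is built
from `h b` and the `f k` with `k < m` alone. -/
theorem root_lie_e {m : ℕ} (h2 : m < n) {a b : ℕ} (a1 : 1 ≤ a) (a2 : a ≤ m)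
    (b1 : 1 ≤ b) (b2 : b < m) : ⁅root h e f a b, e m⁆ = 0 := by
  have key : ∀ b, 1 ≤ b → b < m → ⁅h b, e m⁆ = 0 := by
    intro b b1 b2
    rw [R.he b m b1 (by omega) (by omega) h2, kron_of_ne (by omega), kron_of_ne (by omega)]; simp
  rcases le_total a b with hab | hab
  · refine root_lie_eq_zero (m := b) (fun c c1 c2 => key c c1 (by omega))
      (fun k k1 k2 => R.ee k m k1 (by omega) h2) (fun k k1 k2 => ?_) a1 hab b1 le_rfl
    rw [← lie_skew, R.ef_ne m k (by omega) h2 k1 (by omega) (by omega), neg_zero]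
  · induction a, hab using Nat.le_induction with
    | base => rw [root_self]; exact key b b1 b2
    | succ a hab ih =>
      rw [root_down hab]
      refine lie_lie_eq_zero ?_ (ih (by omega) (by omega))
      rw [← lie_skew, R.ef_ne m a (by omega) h2 (by omega) (by omega) (by omega), neg_zero]

/-- The last column is a standard module of `gl_m`. -/
theorem root_lie_column {m : ℕ} (h2 : m < n) (G : MatrixRelations m (root h e f))
    {a b c : ℕ} (a1 : 1 ≤ a) (a2 : a ≤ m) (b1 : 1 ≤ b) (b2 : b ≤ m) (c1 : 1 ≤ c) (c2 : c ≤ m) :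
    ⁅root h e f a b, root h e f c (m + 1)⁆ = kron b c • root h e f a (m + 1) := by
  -- For `b < m` the element `E_{ab}` commutes with `e m`, and the Leibniz rule reduces the claim to
  -- `gl_m`.
  have B1 : ∀ a b c, 1 ≤ a → a ≤ m → 1 ≤ b → b < m → 1 ≤ c → c ≤ m →
      ⁅root h e f a b, root h e f c (m + 1)⁆ = kron b c • root h e f a (m + 1) := by
    intro a b c a1 a2 b1 b2 c1 c2
    rw [root_up c2, root_up a2, leibniz_lie, R.root_lie_e h2 a1 a2 b1 b2,
      G a b c m a1 a2 b1 b2.le c1 c2 (by omega) le_rfl, sub_lie, smul_lie, smul_lie,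
      R.root_lie_e h2 c1 c2 b1 b2]
    simp
  rcases b2.lt_or_eq with b2 | rfl
  · exact B1 a b c a1 a2 b1 b2 c1 c2
  rcases c2.lt_or_eq with c2 | rfl
  swap
  · rw [R.root_succ c1 h2, kron_self, one_smul, root_up a2]
  rw [kron_of_ne (by omega), zero_smul]
  rcases a2.lt_or_eq with a2 | rfl
  swap
  · rw [root_up c2.le, leibniz_lie, G a a c a a1 le_rfl a1 le_rfl c1 c2.le a1 le_rfl,
      kron_of_ne (by omega), kron_self, root_self, R.he a a a1 (by omega) a1 h2, kron_self,
      kron_of_ne (show a ≠ a + 1 by omega)]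
    simp only [zero_smul, one_smul, zero_sub, sub_zero, neg_lie]
    rw [lie_skew, ← lie_skew, neg_add_cancel]
  -- What remains is `[E_{a,m}, E_{c,m+1}] = 0` for `a, c < m = p + 1`. This bracket is symmetric in
  -- `a` and `c`, and for `a = c = p` it is a Serre relation. Acting with `E_{cp}` on that case
  -- gives twice the case `(c, p)`; acting on the case `(a, p)` then gives all others.
  obtain ⟨p, rfl⟩ : ∃ p, b = p + 1 := ⟨b - 1, by omega⟩
  have p1 : 1 ≤ p := by omega
  set X := root h e f with hX
  have act1 : ∀ a d, 1 ≤ a → a ≤ p → 1 ≤ d → d ≤ p →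
      ⁅X a p, X d (p + 1)⁆ = kron p d • X a (p + 1) := by
    intro a d a1 a2 d1 d2
    rw [G a p d (p + 1) a1 (by omega) p1 (by omega) d1 (by omega) b1 le_rfl,
      kron_of_ne (show p + 1 ≠ a by omega)]
    simp
  have act : ∀ a c d, 1 ≤ a → a ≤ p → 1 ≤ c → c ≤ p → 1 ≤ d → d ≤ p →
      ⁅X a p, ⁅X c (p + 1), X d (p + 2)⁆⁆ =
        kron p c • ⁅X a (p + 1), X d (p + 2)⁆ + kron p d • ⁅X c (p + 1), X a (p + 2)⁆ := by
    intro a c d a1 a2 c1 c2 d1 d2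
    rw [leibniz_lie, act1 a c a1 a2 c1 c2, B1 a p d a1 (by omega) p1 (by omega) d1 (by omega)]
    simp
  have symm : ∀ a c, 1 ≤ a → a ≤ p → 1 ≤ c → c ≤ p →
      ⁅X a (p + 1), X c (p + 2)⁆ = ⁅X c (p + 1), X a (p + 2)⁆ := by
    intro a c a1 a2 c1 c2
    rw [hX, root_up (show c ≤ p + 1 by omega), root_up (show a ≤ p + 1 by omega), leibniz_lie,
      ← hX, G a (p + 1) c (p + 1) a1 (by omega) b1 le_rfl c1 (by omega) b1 le_rfl,
      kron_of_ne (show p + 1 ≠ c by omega), kron_of_ne (show p + 1 ≠ a by omega)]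
    simp
  have base : ⁅X p (p + 1), X p (p + 2)⁆ = 0 := by
    rw [hX, root_up (show p ≤ p + 1 by omega), R.root_succ p1 (by omega)]
    exact R.eee_left p p1 h2
  have edge : ∀ c, 1 ≤ c → c ≤ p → ⁅X c (p + 1), X p (p + 2)⁆ = 0 := by
    intro c c1 c2
    have := act c p p c1 c2 p1 le_rfl p1 le_rfl
    rw [base, lie_zero, kron_self, one_smul, one_smul, symm p c p1 le_rfl c1 c2, ← two_smul ℂ]
      at this
    simpa using this.symm
  have := act c a p c1 (by omega) a1 (by omega) p1 le_rfl
  rw [edge a a1 (by omega), edge c c1 (by omega), kron_self, lie_zero] at this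
  simpa using this.symm

/-- The last column is commutative. -/
theorem column_lie_column {m : ℕ} (h2 : m < n) (G : MatrixRelations m (root h e f))
    {a c : ℕ} (a1 : 1 ≤ a) (a2 : a ≤ m) (c1 : 1 ≤ c) (c2 : c ≤ m) :
    ⁅root h e f a (m + 1), root h e f c (m + 1)⁆ = 0 := by
  rcases eq_or_ne a c with rfl | hac
  · exact lie_self _
  -- The case `(p, p + 1)` is the other Serre relation; the action of `gl_m` moves first the index
  -- `p`, then the index `p + 1`.
  obtain ⟨p, rfl⟩ : ∃ p, m = p + 1 := ⟨m - 1, by omega⟩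
  have p1 : 1 ≤ p := by omega
  set X := root h e f with hX
  have act : ∀ a b c d, 1 ≤ a → a ≤ p + 1 → 1 ≤ b → b ≤ p + 1 → 1 ≤ c → c ≤ p + 1 →
      1 ≤ d → d ≤ p + 1 → ⁅X a b, ⁅X c (p + 2), X d (p + 2)⁆⁆ =
        kron b c • ⁅X a (p + 2), X d (p + 2)⁆ + kron b d • ⁅X c (p + 2), X a (p + 2)⁆ := by
    intro a b c d a1 a2 b1 b2 c1 c2 d1 d2
    rw [leibniz_lie, R.root_lie_column h2 G a1 a2 b1 b2 c1 c2,
      R.root_lie_column h2 G a1 a2 b1 b2 d1 d2]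
    simp [hX]
  have base : ⁅X p (p + 2), X (p + 1) (p + 2)⁆ = 0 := by
    rw [hX, root_up (show p ≤ p + 1 by omega), R.root_succ p1 (by omega),
      R.root_succ (show 1 ≤ p + 1 by omega) h2]
    exact R.eee_right p p1 h2
  have edge : ∀ a, 1 ≤ a → a ≤ p → ⁅X a (p + 2), X (p + 1) (p + 2)⁆ = 0 := by
    intro a a1 a2
    have := act a p p (p + 1) a1 (by omega) p1 (by omega) p1 (by omega) (by omega) le_rfl
    rw [base, lie_zero, kron_self, kron_of_ne (show p ≠ p + 1 by omega)] at this
    simpa using this.symm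
  rcases a2.lt_or_eq with a2 | rfl
  · rcases c2.lt_or_eq with c2 | rfl
    · have := act c (p + 1) a (p + 1) c1 (by omega) (by omega) le_rfl a1 (by omega) (by omega)
        le_rfl
      rw [edge a a1 (by omega), lie_zero, kron_self, kron_of_ne (show p + 1 ≠ a by omega)] at this
      simpa using this.symm
    · exact edge a a1 (by omega)
  · rw [← lie_skew, edge c c1 (by omega), neg_zero]

theorem h_lie_root {m : ℕ} (h2 : m < n) {a b : ℕ} (a1 : 1 ≤ a) (a2 : a ≤ m)
    (b1 : 1 ≤ b) (b2 : b ≤ m) : ⁅root h e f a b, h (m + 1)⁆ = 0 := by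
  refine root_lie_eq_zero (m := m) (fun c c1 c2 => ?_) (fun k k1 k2 => ?_) (fun k k1 k2 => ?_)
    a1 a2 b1 b2
  · exact R.hh c (m + 1) c1 (by omega) (by omega) (by omega)
  · rw [← lie_skew, R.he (m + 1) k (by omega) (by omega) k1 (by omega), kron_of_ne (by omega),
      kron_of_ne (by omega)]
    simp
  · rw [← lie_skew, R.hf (m + 1) k (by omega) (by omega) k1 (by omega), kron_of_ne (by omega),
      kron_of_ne (by omega)]
    simp

theorem h_lie_column {m : ℕ} (h2 : m < n) {a : ℕ} (a1 : 1 ≤ a) (a2 : a ≤ m) :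
    ⁅h (m + 1), root h e f a (m + 1)⁆ = -root h e f a (m + 1) := by
  rw [root_up a2, leibniz_lie, ← lie_skew (h (m + 1)) (root h e f a m),
    R.h_lie_root h2 a1 a2 (by omega) le_rfl,
    R.he (m + 1) m (by omega) (by omega) (by omega) h2, kron_self, kron_of_ne (by omega)]
  simp

/-- The row statements are the transposes of the column statements under the Chevalley involution.
-/
theorem root_lie_row {m : ℕ} (h2 : m < n) (G : MatrixRelations m (root h e f))
    {a b c : ℕ} (a1 : 1 ≤ a) (a2 : a ≤ m) (b1 : 1 ≤ b) (b2 : b ≤ m) (c1 : 1 ≤ c) (c2 : c ≤ m) :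
    ⁅root h e f a b, root h e f (m + 1) c⁆ = -(kron a c • root h e f (m + 1) b) := by
  have := R.involution.root_lie_column h2 G.involution b1 b2 a1 a2 c1 c2
  simpa [root_involution] using this

theorem row_lie_row {m : ℕ} (h2 : m < n) (G : MatrixRelations m (root h e f))
    {a c : ℕ} (a1 : 1 ≤ a) (a2 : a ≤ m) (c1 : 1 ≤ c) (c2 : c ≤ m) :
    ⁅root h e f (m + 1) a, root h e f (m + 1) c⁆ = 0 := by
  have := R.involution.column_lie_column h2 G.involution a1 a2 c1 c2
  simpa [root_involution] using this

theorem h_lie_row {m : ℕ} (h2 : m < n) {a : ℕ} (a1 : 1 ≤ a) (a2 : a ≤ m) :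
    ⁅h (m + 1), root h e f (m + 1) a⁆ = root h e f (m + 1) a := by
  have := R.involution.h_lie_column h2 a1 a2
  simpa [root_involution] using this

/-- For `a = b = m` this is the relation `ef`. Acting with `E_{am}` changes the column index, then
acting with `E_{mb}` changes the row index. -/
theorem column_lie_row {m : ℕ} (h2 : m < n) (G : MatrixRelations m (root h e f))
    {a b : ℕ} (a1 : 1 ≤ a) (a2 : a ≤ m) (b1 : 1 ≤ b) (b2 : b ≤ m) :
    ⁅root h e f a (m + 1), root h e f (m + 1) b⁆ = root h e f a b - kron a b • h (m + 1) := by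
  have m1 : 1 ≤ m := by omega
  set X := root h e f with hX
  have act : ∀ p q a b, 1 ≤ p → p ≤ m → 1 ≤ q → q ≤ m → 1 ≤ a → a ≤ m → 1 ≤ b → b ≤ m →
      ⁅X p q, ⁅X a (m + 1), X (m + 1) b⁆⁆ =
        kron q a • ⁅X p (m + 1), X (m + 1) b⁆ - kron p b • ⁅X a (m + 1), X (m + 1) q⁆ := by
    intro p q a b p1 p2 q1 q2 a1 a2 b1 b2
    rw [leibniz_lie, R.root_lie_column h2 G p1 p2 q1 q2 a1 a2,
      R.root_lie_row h2 G p1 p2 q1 q2 b1 b2]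
    simp [hX, sub_eq_add_neg]
  have base : ⁅X m (m + 1), X (m + 1) m⁆ = X m m - h (m + 1) := by
    rw [hX, R.root_pred m1 h2, R.root_succ m1 h2, R.ef m m1 h2, root_self]
  have col : ∀ a, 1 ≤ a → a ≤ m → ⁅X a (m + 1), X (m + 1) m⁆ = X a m - kron a m • h (m + 1) := by
    intro a a1 a2
    rcases a2.lt_or_eq with a2 | rfl
    · have := act a m m m a1 a2.le m1 le_rfl m1 le_rfl m1 le_rfl
      rw [base, lie_sub, R.h_lie_root h2 a1 a2.le m1 le_rfl,
        G a m m m a1 a2.le m1 le_rfl m1 le_rfl m1 le_rfl, kron_self, kron_of_ne a2.ne,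
        kron_of_ne a2.ne'] at this
      rw [kron_of_ne a2.ne]
      simpa using this.symm
    · rw [base, kron_self, one_smul]
  rcases b2.lt_or_eq with b2 | rfl
  · have := act m b a m m1 le_rfl b1 b2.le a1 a2 m1 le_rfl
    rw [col a a1 a2, base, lie_sub, lie_smul, R.h_lie_root h2 m1 le_rfl b1 b2.le,
      G m b a m m1 le_rfl b1 b2.le a1 a2 m1 le_rfl, kron_self, one_smul, smul_sub, one_smul,
      smul_zero, sub_zero, kron_comm b a] at this
    have h3 := congrArg (fun z => kron a b • X m m - kron a b • h (m + 1) - z) this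
    simp only [sub_sub_cancel] at h3
    rw [← h3]; abel
  · exact col a a1 a2

/-- The Chevalley-Serre relations imply the relations between all elementary matrices. -/
theorem matrixRelations {m : ℕ} (h1 : 1 ≤ m) (h2 : m ≤ n) :
    MatrixRelations m (root h e f) := by
  induction m, h1 using Nat.le_induction with
  | base =>
    intro a b c d a1 a2 b1 b2 c1 c2 d1 d2
    obtain rfl : a = 1 := by omega
    obtain rfl : b = 1 := by omega
    obtain rfl : c = 1 := by omega
    obtain rfl : d = 1 := by omega
    simp
  | succ m m1 ih =>
    have G := ih (by omega)
    have hm : m < n := by omega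
    intro a b c d a1 a2 b1 b2 c1 c2 d1 d2
    -- Each of the two factors lies in `gl_m`, in the new column, in the new row, or is the new
    -- diagonal element: sixteen cases.
    rcases Nat.le_succ_iff.1 a2 with a2 | rfl <;> rcases Nat.le_succ_iff.1 b2 with b2 | rfl <;>
      rcases Nat.le_succ_iff.1 c2 with c2 | rfl <;> rcases Nat.le_succ_iff.1 d2 with d2 | rfl
    · exact G a b c d a1 a2 b1 b2 c1 c2 d1 d2
    · rw [R.root_lie_column hm G a1 a2 b1 b2 c1 c2, kron_of_ne (show m + 1 ≠ a by omega)]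
      simp
    · rw [R.root_lie_row hm G a1 a2 b1 b2 d1 d2, kron_of_ne (show b ≠ m + 1 by omega),
        kron_comm d a]
      simp
    · rw [root_self, R.h_lie_root hm a1 a2 b1 b2, kron_of_ne (show b ≠ m + 1 by omega),
        kron_of_ne (show m + 1 ≠ a by omega)]
      simp
    · rw [← lie_skew, R.root_lie_column hm G c1 c2 d1 d2 a1 a2,
        kron_of_ne (show m + 1 ≠ c by omega)]
      simp
    · rw [R.column_lie_column hm G a1 a2 c1 c2, kron_of_ne (show m + 1 ≠ c by omega),
        kron_of_ne (show m + 1 ≠ a by omega)]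
      simp
    · rw [R.column_lie_row hm G a1 a2 d1 d2, root_self, kron_self, kron_comm d a]
      simp
    · rw [root_self, ← lie_skew, R.h_lie_column hm a1 a2, kron_self,
        kron_of_ne (show m + 1 ≠ a by omega)]
      simp
    · rw [← lie_skew, R.root_lie_row hm G c1 c2 d1 d2 b1 b2, kron_of_ne (show d ≠ m + 1 by omega),
        kron_comm b c]
      simp
    · rw [← lie_skew, R.column_lie_row hm G c1 c2 b1 b2, root_self, kron_self, kron_comm b c]
      simp
    · rw [R.row_lie_row hm G b1 b2 d1 d2, kron_of_ne (show b ≠ m + 1 by omega),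
        kron_of_ne (show d ≠ m + 1 by omega)]
      simp
    · rw [root_self, ← lie_skew, R.h_lie_row hm b1 b2, kron_of_ne (show b ≠ m + 1 by omega),
        kron_self]
      simp
    · rw [root_self, ← lie_skew, R.h_lie_root hm c1 c2 d1 d2, kron_of_ne (show m + 1 ≠ c by omega),
        kron_of_ne (show d ≠ m + 1 by omega)]
      simp
    · rw [root_self, R.h_lie_column hm c1 c2, kron_of_ne (show m + 1 ≠ c by omega), kron_self]
      simp
    · rw [root_self, R.h_lie_row hm d1 d2, kron_of_ne (show d ≠ m + 1 by omega), kron_self]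
      simp
    · simp

end ChevalleyRelations

/-- Elements that satisfy the relations of the elementary matrices define a representation. -/
theorem MatrixRelations.exists_lieHom {n : ℕ} {X : ℕ → ℕ → A} (G : MatrixRelations n X) :
    letI := LieRing.ofAssociativeRing (A := Matrix (Fin n) (Fin n) ℂ)
    ∃ ρ : Matrix (Fin n) (Fin n) ℂ →ₗ⁅ℂ⁆ A,
      ∀ a b, 1 ≤ a → a ≤ n → 1 ≤ b → b ≤ n → ρ (E n a b) = X a b := by
  let := LieRing.ofAssociativeRing (A := Matrix (Fin n) (Fin n) ℂ)
  let φ : Matrix (Fin n) (Fin n) ℂ →ₗ[ℂ] A :=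
    { toFun := fun M => ∑ p, ∑ q, M p q • X (p.val + 1) (q.val + 1)
      map_add' := fun M N => by simp only [Matrix.add_apply, add_smul, Finset.sum_add_distrib]
      map_smul' := fun c M => by
        simp only [Matrix.smul_apply, smul_eq_mul, mul_smul, Finset.smul_sum, RingHom.id_apply] }
  have hG : ∀ p q r s : Fin n, ⁅X (p.val + 1) (q.val + 1), X (r.val + 1) (s.val + 1)⁆ =
      (if q = r then X (p.val + 1) (s.val + 1) else 0) -
        (if s = p then X (r.val + 1) (q.val + 1) else 0) := by
    intro p q r s
    rw [G _ _ _ _ (by omega) (by omega) (by omega) (by omega) (by omega) (by omega) (by omega)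
      (by omega)]
    simp only [kron, Nat.add_right_cancel_iff, Fin.val_inj, ite_smul, one_smul, zero_smul]
  refine ⟨{ φ with map_lie' := fun {M N} => ?_ }, fun a b a1 a2 b1 b2 => ?_⟩
  · change φ ⁅M, N⁆ = ⁅φ M, φ N⁆
    have e1 : ⁅φ M, φ N⁆ = ∑ p, ∑ q, ∑ r, ∑ s, (M p q * N r s) •
        ⁅X (p.val + 1) (q.val + 1), X (r.val + 1) (s.val + 1)⁆ := by
      simp only [φ, LinearMap.coe_mk, AddHom.coe_mk]
      rw [sum_lie]
      refine Finset.sum_congr rfl fun p _ => ?_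
      rw [sum_lie]
      refine Finset.sum_congr rfl fun q _ => ?_
      rw [lie_sum]
      refine Finset.sum_congr rfl fun r _ => ?_
      rw [lie_sum]
      refine Finset.sum_congr rfl fun s _ => ?_
      rw [smul_lie, lie_smul, smul_smul]
    rw [e1]
    simp only [hG, smul_sub, Finset.sum_sub_distrib, smul_ite, smul_zero]
    rw [Ring.lie_def, map_sub]
    congr 1
    · simp only [φ, LinearMap.coe_mk, AddHom.coe_mk, Matrix.mul_apply, Finset.sum_smul]
      refine Finset.sum_congr rfl fun p _ => ?_
      rw [Finset.sum_comm]
      refine Finset.sum_congr rfl fun q _ => ?_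
      rw [Finset.sum_comm]
      refine Finset.sum_congr rfl fun s _ => ?_
      simp
    · simp only [φ, LinearMap.coe_mk, AddHom.coe_mk, Matrix.mul_apply, Finset.sum_smul]
      simp only [Finset.sum_ite_eq', Finset.mem_univ, if_true]
      rw [Finset.sum_comm]
      conv_rhs => rw [Finset.sum_comm]
      refine Finset.sum_congr rfl fun q _ => ?_
      rw [Finset.sum_comm]
      simp only [mul_comm]
  · change φ (E n a b) = X a b
    simp only [φ, LinearMap.coe_mk, AddHom.coe_mk, E, Matrix.of_apply, ite_smul, one_smul,
      zero_smul]
    rw [Finset.sum_eq_single ⟨a - 1, by omega⟩, Finset.sum_eq_single ⟨b - 1, by omega⟩]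
    · simp [Nat.sub_add_cancel a1, Nat.sub_add_cancel b1]
    · intro q _ hq
      rw [if_neg]
      rintro ⟨_, h⟩
      exact hq (Fin.ext (by simp; omega))
    · simp
    · intro p _ hp
      refine Finset.sum_eq_zero fun q _ => if_neg ?_
      rintro ⟨h, _⟩
      exact hp (Fin.ext (by simp; omega))
    · simp

end Chevalley

end GelfandGraev

namespace GelfandGraev

/-! ### Compression of operators to convex sets of basis vectors. -/

section Truncation

variable {G : Type*}

/-- An operator is triangular for `r` if its nonzero matrix coefficients respect `r`. -/
def Triangular (r : G → G → Prop) (A : Module.End ℂ (G →₀ ℂ)) : Prop :=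
  ∀ L M, A (Finsupp.single L 1) M ≠ 0 → r L M

/-- The compression of an operator to the span of some of the basis vectors. -/
noncomputable def trunc (B : Set G) (A : Module.End ℂ (G →₀ ℂ)) : Module.End ℂ (B →₀ ℂ) :=
  Finsupp.lsubtypeDomain B ∘ₗ A ∘ₗ Finsupp.lmapDomain ℂ ℂ (Subtype.val : B → G)

variable {r : G → G → Prop} {B : Set G} {A A' : Module.End ℂ (G →₀ ℂ)}

theorem apply_eq_sum (A : Module.End ℂ (G →₀ ℂ)) (u : G →₀ ℂ) (M : G) :
    A u M = u.sum fun N c => c * A (Finsupp.single N 1) M := by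
  conv_lhs => rw [← Finsupp.sum_single u]
  rw [Finsupp.sum, map_sum, Finsupp.finsetSum_apply]
  refine Finset.sum_congr rfl fun N _ => ?_
  rw [← mul_one (u N), ← smul_eq_mul, ← Finsupp.smul_single, map_smul, Finsupp.smul_apply]
  simp

theorem trunc_apply (A : Module.End ℂ (G →₀ ℂ)) (u : B →₀ ℂ) (M : B) :
    trunc B A u M = A (u.mapDomain Subtype.val) M := rfl

theorem trunc_single (A : Module.End ℂ (G →₀ ℂ)) (L : B) (c : ℂ) (M : B) :
    trunc B A (Finsupp.single L c) M = A (Finsupp.single L.1 c) M := by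
  rw [trunc_apply, Finsupp.mapDomain_single]

theorem trunc_sub (A A' : Module.End ℂ (G →₀ ℂ)) :
    trunc B (A - A') = trunc B A - trunc B A' := by
  ext L M; simp [trunc_single]

theorem trunc_smul (c : ℂ) (A : Module.End ℂ (G →₀ ℂ)) :
    trunc B (c • A) = c • trunc B A := by
  ext L M; simp [trunc_single]

theorem trunc_zero : trunc B (0 : Module.End ℂ (G →₀ ℂ)) = 0 := by
  ext L M; simp [trunc_single]

theorem Triangular.mul (hr : ∀ L M N, r L M → r M N → r L N) (hA : Triangular r A)
    (hA' : Triangular r A') : Triangular r (A * A') := by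
  intro L M h
  rw [Module.End.mul_apply, apply_eq_sum] at h
  obtain ⟨N, _, hN⟩ := Finset.exists_ne_zero_of_sum_ne_zero h
  exact hr _ _ _ (hA' L N (left_ne_zero_of_mul hN)) (hA N M (right_ne_zero_of_mul hN))

theorem Triangular.sub (hA : Triangular r A) (hA' : Triangular r A') :
    Triangular r (A - A') := by
  intro L M h
  by_contra hr
  have h1 : A (Finsupp.single L 1) M = 0 := by_contra fun h => hr (hA L M h)
  have h2 : A' (Finsupp.single L 1) M = 0 := by_contra fun h => hr (hA' L M h)
  exact h (by simp [h1, h2])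

/-- Compression to a convex set of basis vectors is multiplicative on triangular operators. -/
theorem trunc_mul (hB : ∀ L ∈ B, ∀ M ∈ B, ∀ N, r L N → r N M → N ∈ B) (hA : Triangular r A)
    (hA' : Triangular r A') : trunc B (A * A') = trunc B A * trunc B A' := by
  refine Finsupp.lhom_ext' fun L => LinearMap.ext_ring (Finsupp.ext fun M => ?_)
  simp only [LinearMap.comp_apply, Finsupp.lsingle_apply, Module.End.mul_apply]
  rw [trunc_single, Module.End.mul_apply, trunc_apply]
  set u := A' (Finsupp.single L.1 1) with hu
  set w := (trunc B A' (Finsupp.single L 1)).mapDomain Subtype.val with hw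
  have hsub : ∀ N ∈ B, w N = u N := by
    intro N hN
    have := Finsupp.mapDomain_apply Subtype.val_injective (trunc B A' (Finsupp.single L 1)) ⟨N, hN⟩
    rw [trunc_single] at this
    exact this
  have hout : ∀ N ∉ B, w N = 0 := by
    intro N hN
    exact Finsupp.mapDomain_of_notMem_range _ _ (by simpa using hN)
  -- `w` is the part of `u` supported on `B`. A surviving term of `A (u - w)` at `M` would pass from
  -- `L` to `M` through some `N` outside `B`, against convexity.
  suffices h : A (u - w) M = 0 by
    rw [map_sub, Finsupp.sub_apply, sub_eq_zero] at h
    exact h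
  rw [apply_eq_sum]
  refine Finset.sum_eq_zero fun N _ => ?_
  by_cases hN : N ∈ B
  · simp [hsub N hN]
  · rw [Finsupp.sub_apply, hout N hN, sub_zero]
    by_contra h
    exact hN (hB L L.2 M M.2 N (hA' L N (left_ne_zero_of_mul h))
      (hA N M (right_ne_zero_of_mul h)))

/-- A compression vanishes if no basis vector of the image survives. -/
theorem trunc_eq_zero {ι : Type*} {A : Module.End ℂ (G →₀ ℂ)} (s : Finset ι) (c : ι → G → ℂ)
    (v : ι → G → G)
    (hA : ∀ L, A (Finsupp.single L 1) = ∑ x ∈ s, c x L • Finsupp.single (v x L) 1)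
    (h : ∀ L ∈ B, ∀ x ∈ s, v x L ∈ B → c x L = 0) : trunc B A = 0 := by
  refine Finsupp.lhom_ext' fun L => LinearMap.ext_ring (Finsupp.ext fun M => ?_)
  simp only [LinearMap.comp_apply, Finsupp.lsingle_apply, LinearMap.zero_apply,
    Finsupp.coe_zero, Pi.zero_apply]
  rw [trunc_single, hA, Finsupp.finsetSum_apply]
  refine Finset.sum_eq_zero fun x hx => ?_
  by_cases hM : v x L = M
  · rw [h L L.2 x hx (hM ▸ M.2)]; simp
  · simp [Finsupp.single_eq_of_ne (Ne.symm hM)]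

end Truncation

end GelfandGraev

namespace GelfandGraev

/-! ### The Gelfand-Tsetlin operators on the span of all arrays, and the relations that hold there.
-/

section Coefficients

/-- The array `L` with `ε` added in row `p`, position `r`. -/
def shift (ε : ℤ) (p r : ℕ) (L : ℕ → ℕ → ℤ) : ℕ → ℕ → ℤ := L + ε • delta p r

theorem shift_apply (ε : ℤ) (p r : ℕ) (L : ℕ → ℕ → ℤ) (s t : ℕ) :
    shift ε p r L s t = L s t + if s = p ∧ t = r then ε else 0 := by
  simp [shift, delta]

theorem shift_self (ε : ℤ) (p r : ℕ) (L : ℕ → ℕ → ℤ) : shift ε p r L p r = L p r + ε := by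
  simp [shift_apply]

theorem shift_row {p s : ℕ} (h : s ≠ p) (ε : ℤ) (r : ℕ) (L : ℕ → ℕ → ℤ) :
    shift ε p r L s = L s := by
  funext t; simp [shift_apply, h]

theorem shift_col {r t : ℕ} (h : t ≠ r) (ε : ℤ) (p s : ℕ) (L : ℕ → ℕ → ℤ) :
    shift ε p r L s t = L s t := by
  simp [shift_apply, h]

theorem shift_comm (ε ε' : ℤ) (p p' r r' : ℕ) (L : ℕ → ℕ → ℤ) :
    shift ε p r (shift ε' p' r' L) = shift ε' p' r' (shift ε p r L) := by
  simp only [shift]; abel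

theorem shift_neg_shift (ε : ℤ) (p r : ℕ) (L : ℕ → ℕ → ℤ) :
    shift (-ε) p r (shift ε p r L) = L := by
  simp [shift]

/-- The link of an entry `x` with a set of entries of the row `a`. -/
noncomputable def link (s : Finset ℕ) (a : ℕ → ℤ) (x : ℤ) : ℂ := ∏ m ∈ s, ((x : ℂ) - (a m : ℂ))

theorem link_erase {s : Finset ℕ} {m : ℕ} (hm : m ∈ s) (a : ℕ → ℤ) (x : ℤ) :
    link s a x = ((x : ℂ) - (a m : ℂ)) * link (s.erase m) a x :=
  (Finset.mul_prod_erase s (fun m => (x : ℂ) - (a m : ℂ)) hm).symm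

theorem link_congr {s : Finset ℕ} {a b : ℕ → ℤ} (h : ∀ m ∈ s, a m = b m) (x : ℤ) :
    link s a x = link s b x :=
  Finset.prod_congr rfl fun m hm => by rw [h m hm]

theorem link_shift_erase (s : Finset ℕ) (ε : ℤ) (q m : ℕ) (L : ℕ → ℕ → ℤ) (x : ℤ) :
    link (s.erase m) (shift ε q m L q) x = link (s.erase m) (L q) x :=
  link_congr (fun _ ht => shift_col (Finset.ne_of_mem_erase ht) _ _ _ _) x

theorem link_ne_zero {s : Finset ℕ} {a : ℕ → ℤ} {x : ℤ} (h : ∀ m ∈ s, x ≠ a m) :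
    link s a x ≠ 0 :=
  Finset.prod_ne_zero_iff.2 fun m hm => sub_ne_zero.2 (by exact_mod_cast h m hm)

theorem link_eq_zero {s : Finset ℕ} {a : ℕ → ℤ} {m : ℕ} (hm : m ∈ s) : link s a (a m) = 0 :=
  Finset.prod_eq_zero hm (sub_self _)

/-- The Gelfand-Tsetlin coefficient of the entry `(p, r)` linked with row `q`. -/
noncomputable def coef (p q r : ℕ) (L : ℕ → ℕ → ℤ) : ℂ :=
  link (Finset.Icc 1 q) (L q) (L p r) / link ((Finset.Icc 1 p).erase r) (L p) (L p r)

theorem eCoeff_eq (k r : ℕ) (L : ℕ → ℕ → ℤ) : eCoeff k r L = -coef k (k + 1) r L := rfl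

theorem fCoeff_eq (k r : ℕ) (L : ℕ → ℕ → ℤ) : fCoeff k r L = coef k (k - 1) r L := rfl

theorem coef_shift {p q u : ℕ} (hp : p ≠ u) (hq : q ≠ u) (r : ℕ) (ε : ℤ) (t : ℕ)
    (L : ℕ → ℕ → ℤ) : coef p q r (shift ε u t L) = coef p q r L := by
  simp only [coef, shift_row hp, shift_row hq]

/-- The denominator after a shift of another entry of the same row. -/
theorem link_shift_row {s : Finset ℕ} {p r t : ℕ} (ht : t ∈ s) (hrt : r ≠ t) (ε : ℤ)
    (L : ℕ → ℕ → ℤ) :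
    link (s.erase r) (shift ε p t L p) (shift ε p t L p r) =
      ((L p r : ℂ) - L p t - ε) * link ((s.erase r).erase t) (L p) (L p r) := by
  rw [link_erase (Finset.mem_erase.2 ⟨hrt.symm, ht⟩), shift_self, shift_col hrt, link_shift_erase]
  push_cast; ring

/-- The coefficient after a shift in the linked row. -/
theorem coef_shift_link {p q r s : ℕ} (hs : s ∈ Finset.Icc 1 q) (hpq : p ≠ q) (ε : ℤ)
    (L : ℕ → ℕ → ℤ) :
    coef p q r (shift ε q s L) = ((L p r : ℂ) - L q s - ε) *
      (link ((Finset.Icc 1 q).erase s) (L q) (L p r) /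
        link ((Finset.Icc 1 p).erase r) (L p) (L p r)) := by
  rw [coef, link_erase hs, shift_self, shift_row hpq, link_shift_erase]
  push_cast; ring

/-- Isolates the only factor that a shift of the entry `(q, s)` changes, in the shape of
`coef_shift_link`. -/
theorem coef_eq {p q r s : ℕ} (hs : s ∈ Finset.Icc 1 q) (L : ℕ → ℕ → ℤ) :
    coef p q r L = ((L p r : ℂ) - L q s) *
      (link ((Finset.Icc 1 q).erase s) (L q) (L p r) /
        link ((Finset.Icc 1 p).erase r) (L p) (L p r)) := by
  rw [coef, link_erase hs]; ring

theorem coef_eq_row {p q r t : ℕ} (ht : t ∈ Finset.Icc 1 p) (hrt : r ≠ t) (L : ℕ → ℕ → ℤ) :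
    coef p q r L = link (Finset.Icc 1 q) (L q) (L p r) /
        (((L p r : ℂ) - L p t) * link (((Finset.Icc 1 p).erase r).erase t) (L p) (L p r)) := by
  rw [coef, link_erase (s := (Finset.Icc 1 p).erase r) (m := t) (by simp_all [hrt.symm])]

theorem coef_shift_row {p q r t : ℕ} (hpq : q ≠ p) (ht : t ∈ Finset.Icc 1 p) (hrt : r ≠ t) (ε : ℤ)
    (L : ℕ → ℕ → ℤ) :
    coef p q r (shift ε p t L) = link (Finset.Icc 1 q) (L q) (L p r) /
        (((L p r : ℂ) - L p t - ε) *
          link (((Finset.Icc 1 p).erase r).erase t) (L p) (L p r)) := by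
  rw [coef, link_shift_row ht hrt, shift_row hpq, shift_col hrt]

/-- The operator that shifts the entries of row `p` by `ε`, with coefficients linked with row `q`,
on the space spanned by all arrays. -/
noncomputable def stepOp (ε : ℤ) (p q : ℕ) : Module.End ℂ ((ℕ → ℕ → ℤ) →₀ ℂ) :=
  Finsupp.linearCombination ℂ fun L =>
    ∑ r ∈ Finset.Icc 1 p, coef p q r L • Finsupp.single (shift ε p r L) 1

theorem stepOp_single (ε : ℤ) (p q : ℕ) (L : ℕ → ℕ → ℤ) :
    stepOp ε p q (Finsupp.single L 1) =
      ∑ r ∈ Finset.Icc 1 p, coef p q r L • Finsupp.single (shift ε p r L) 1 := by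
  simp [stepOp]

/-- The diagonal operator with the given eigenvalues. -/
noncomputable def diagOp (w : (ℕ → ℕ → ℤ) → ℂ) : Module.End ℂ ((ℕ → ℕ → ℤ) →₀ ℂ) :=
  Finsupp.linearCombination ℂ fun L => w L • Finsupp.single L 1

theorem diagOp_single (w : (ℕ → ℕ → ℤ) → ℂ) (L : ℕ → ℕ → ℤ) :
    diagOp w (Finsupp.single L 1) = w L • Finsupp.single L 1 := by
  simp [diagOp]

theorem stepOp_mul_single (ε ε' : ℤ) (p q p' q' : ℕ) (L : ℕ → ℕ → ℤ) :
    (stepOp ε p q * stepOp ε' p' q') (Finsupp.single L 1) =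
      ∑ r ∈ Finset.Icc 1 p, ∑ s ∈ Finset.Icc 1 p',
        (coef p' q' s L * coef p q r (shift ε' p' s L)) •
          Finsupp.single (shift ε p r (shift ε' p' s L)) 1 := by
  rw [Module.End.mul_apply, stepOp_single, map_sum, Finset.sum_comm]
  refine Finset.sum_congr rfl fun s _ => ?_
  rw [map_smul, stepOp_single, Finset.smul_sum]
  simp only [smul_smul]

theorem stepOp_commutator_single (ε ε' : ℤ) (p q p' q' : ℕ) (L : ℕ → ℕ → ℤ) :
    (stepOp ε p q * stepOp ε' p' q' - stepOp ε' p' q' * stepOp ε p q) (Finsupp.single L 1) =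
      ∑ r ∈ Finset.Icc 1 p, ∑ s ∈ Finset.Icc 1 p',
        (coef p' q' s L * coef p q r (shift ε' p' s L) -
          coef p q r L * coef p' q' s (shift ε p r L)) •
          Finsupp.single (shift ε p r (shift ε' p' s L)) 1 := by
  rw [LinearMap.sub_apply, stepOp_mul_single, stepOp_mul_single]
  conv_lhs => rw [Finset.sum_comm (s := Finset.Icc 1 p')]
  simp only [← Finset.sum_sub_distrib, sub_smul, shift_comm ε' ε]

theorem stepOp_commute {ε ε' : ℤ} {p q p' q' : ℕ}
    (h : ∀ L, ∀ r ∈ Finset.Icc 1 p, ∀ s ∈ Finset.Icc 1 p',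
      coef p' q' s L * coef p q r (shift ε' p' s L) =
          coef p q r L * coef p' q' s (shift ε p r L)) :
    stepOp ε p q * stepOp ε' p' q' - stepOp ε' p' q' * stepOp ε p q = 0 := by
  refine Finsupp.lhom_ext' fun L => LinearMap.ext_ring ?_
  simp only [LinearMap.comp_apply, Finsupp.lsingle_apply, LinearMap.zero_apply]
  rw [stepOp_commutator_single]
  refine Finset.sum_eq_zero fun r hr => Finset.sum_eq_zero fun s hs => ?_
  rw [h L r hr s hs, sub_self, zero_smul]

/-- Operators on unrelated rows commute. -/
theorem stepOp_commute_of_ne {ε ε' : ℤ} {p q p' q' : ℕ} (h1 : p ≠ p') (h2 : p ≠ q')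
    (h3 : p' ≠ q) :
    stepOp ε p q * stepOp ε' p' q' - stepOp ε' p' q' * stepOp ε p q = 0 := by
  refine stepOp_commute fun L r _ s _ => ?_
  rw [coef_shift h1 h3.symm, coef_shift h1.symm h2.symm]
  ring

/-- Opposite shifts of two rows that are linked with each other commute. -/
theorem stepOp_commute_opposite (ε : ℤ) {p q : ℕ} (h : p ≠ q) :
    stepOp ε p q * stepOp (-ε) q p - stepOp (-ε) q p * stepOp ε p q = 0 := by
  refine stepOp_commute fun L r hr s hs => ?_
  -- With `d = l_{pr} - l_{qs}`, the factors that change multiply to `-d (d + ε)` in either order.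
  rw [coef_shift_link hs h, coef_shift_link hr h.symm, coef_eq hr, coef_eq hs]
  push_cast; ring

/-- Opposite shifts of one row commute up to a diagonal operator. -/
theorem stepOp_commutator_diag {p q q' : ℕ} (hq : q ≠ p) (hq' : q' ≠ p) :
    stepOp 1 p q * stepOp (-1) p q' - stepOp (-1) p q' * stepOp 1 p q =
      diagOp fun L => ∑ r ∈ Finset.Icc 1 p, (coef p q' r L * coef p q r (shift (-1) p r L) -
          coef p q r L * coef p q' r (shift 1 p r L)) := by
  refine Finsupp.lhom_ext' fun L => LinearMap.ext_ring ?_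
  simp only [LinearMap.comp_apply, Finsupp.lsingle_apply]
  rw [stepOp_commutator_single, diagOp_single, Finset.sum_smul]
  refine Finset.sum_congr rfl fun r hr => ?_
  rw [Finset.sum_eq_single r]
  · rw [shift_comm, shift_neg_shift]
  -- For two different entries, with difference `d`, both orders have the factor `-d (d + 1)` in the
  -- denominator. The denominators coincide as products, so the terms cancel even where these
  -- vanish.
  · intro s hs hsr
    rw [coef_shift_row hq hs hsr.symm, coef_shift_row hq' hr hsr, coef_eq_row hr hsr,
      coef_eq_row hs hsr.symm]
    convert zero_smul ℂ _
    rw [sub_eq_zero, div_mul_div_comm, div_mul_div_comm]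
    push_cast
    congr 1
    · ring
    · ring
  · exact fun h => absurd hr h

theorem weight_shift {a p r : ℕ} (ha : 1 ≤ a) (hr : r ∈ Finset.Icc 1 p) (ε : ℤ)
    (L : ℕ → ℕ → ℤ) :
    weight a (shift ε p r L) = weight a L + ε * (kron a p - kron a (p + 1)) := by
  have key : ∀ b, ∑ j ∈ Finset.Icc 1 b, ((shift ε p r L b j : ℤ) : ℂ) =
      ∑ j ∈ Finset.Icc 1 b, (L b j : ℂ) + ε * kron b p := by
    intro b
    rcases eq_or_ne b p with rfl | hb
    · simp only [shift_apply, true_and, Int.cast_add, Finset.sum_add_distrib, kron_self, mul_one]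
      congr 1
      rw [Finset.sum_eq_single r]
      · simp
      · intro j _ hj; simp [hj]
      · exact fun h => absurd hr h
    · rw [shift_row hb, kron_of_ne hb]; simp
  have e1 : kron a (p + 1) = kron (a - 1) p := by
    unfold kron; congr 1; exact propext ⟨fun h => by omega, fun h => by omega⟩
  rw [weight, weight, key, key, e1]; ring

theorem diagOp_commutator {w : (ℕ → ℕ → ℤ) → ℂ} {ε : ℤ} {p q : ℕ} {c : ℂ}
    (h : ∀ L, ∀ r ∈ Finset.Icc 1 p, w (shift ε p r L) = w L + c) :
    diagOp w * stepOp ε p q - stepOp ε p q * diagOp w = c • stepOp ε p q := by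
  refine Finsupp.lhom_ext' fun L => LinearMap.ext_ring ?_
  simp only [LinearMap.comp_apply, Finsupp.lsingle_apply, LinearMap.sub_apply,
    Module.End.mul_apply, LinearMap.smul_apply]
  rw [diagOp_single, map_smul, stepOp_single, map_sum, Finset.smul_sum, Finset.smul_sum,
    ← Finset.sum_sub_distrib]
  refine Finset.sum_congr rfl fun r hr => ?_
  rw [map_smul, diagOp_single, h L r hr]
  module

theorem diagOp_commute (w w' : (ℕ → ℕ → ℤ) → ℂ) :
    diagOp w * diagOp w' - diagOp w' * diagOp w = 0 := by
  refine Finsupp.lhom_ext' fun L => LinearMap.ext_ring ?_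
  simp only [LinearMap.comp_apply, Finsupp.lsingle_apply, LinearMap.sub_apply,
    Module.End.mul_apply, LinearMap.zero_apply]
  rw [diagOp_single, diagOp_single, map_smul, map_smul, diagOp_single, diagOp_single]
  module

end Coefficients

end GelfandGraev

namespace GelfandGraev

/-! ### The Serre relations between neighbouring rows. -/

section Serre

/-- A compression vanishes if the surviving terms cancel in pairs. -/
theorem trunc_eq_zero_of_symm {G : Type*} {B : Set G} {A : Module.End ℂ (G →₀ ℂ)}
    (I J : Finset ℕ) (c : ℕ → ℕ → ℕ → G → ℂ) (v : ℕ → ℕ → ℕ → G → G)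
    (hA : ∀ L, A (Finsupp.single L 1) =
      ∑ r' ∈ I, ∑ r ∈ I, ∑ s ∈ J, c r' r s L • Finsupp.single (v r' r s L) 1)
    (hv : ∀ r' r s L, v r' r s L = v r r' s L)
    (h : ∀ L ∈ B, ∀ r' ∈ I, ∀ r ∈ I, ∀ s ∈ J, v r' r s L ∈ B → c r' r s L + c r r' s L = 0) :
    trunc B A = 0 := by
  -- Doubling the sum pairs each term with the one in which `r` and `r'` are exchanged.
  have h2 : trunc B ((2 : ℂ) • A) = 0 := by
    refine trunc_eq_zero (I ×ˢ I ×ˢ J) (fun x L => c x.1 x.2.1 x.2.2 L + c x.2.1 x.1 x.2.2 L)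
      (fun x L => v x.1 x.2.1 x.2.2 L) (fun L => ?_) (fun L hL x hx hM => ?_)
    · rw [LinearMap.smul_apply, two_smul]
      simp only [Finset.sum_product, add_smul, Finset.sum_add_distrib]
      rw [← hA]
      congr 1
      rw [hA, Finset.sum_comm]
      simp only [hv]
    · simp only [Finset.mem_product] at hx
      exact h L hL _ hx.1 _ hx.2.1 _ hx.2.2 hM
  rw [trunc_smul] at h2
  exact (smul_eq_zero.1 h2).resolve_left two_ne_zero

/-- The commutator of two linked operators. -/
noncomputable def pairOp (ε : ℤ) (p q q' : ℕ) : Module.End ℂ ((ℕ → ℕ → ℤ) →₀ ℂ) :=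
  stepOp ε p q * stepOp ε q q' - stepOp ε q q' * stepOp ε p q

/-- The coefficients of `pairOp`. -/
noncomputable def pairCoef (ε : ℤ) (p q q' r s : ℕ) (L : ℕ → ℕ → ℤ) : ℂ :=
  -ε * coef q q' s L * (link ((Finset.Icc 1 q).erase s) (L q) (L p r) /
        link ((Finset.Icc 1 p).erase r) (L p) (L p r))

variable {ε : ℤ} {p q q' : ℕ}

/-- The two orders differ only in the factor `l_{pr} - l_{qs}`, which is lowered by `ε` in one of
them; the difference leaves `-ε`. -/
theorem pairOp_single (hpq : p ≠ q) (hpq' : p ≠ q') (L : ℕ → ℕ → ℤ) :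
    pairOp ε p q q' (Finsupp.single L 1) =
      ∑ r ∈ Finset.Icc 1 p, ∑ s ∈ Finset.Icc 1 q,
        pairCoef ε p q q' r s L • Finsupp.single (shift ε p r (shift ε q s L)) 1 := by
  rw [pairOp, stepOp_commutator_single]
  refine Finset.sum_congr rfl fun r _ => Finset.sum_congr rfl fun s hs => ?_
  congr 1
  rw [coef_shift_link hs hpq, coef_shift hpq.symm hpq'.symm, coef_eq hs, pairCoef]
  ring

theorem stepOp_pairOp_single (hpq : p ≠ q) (hpq' : p ≠ q') (L : ℕ → ℕ → ℤ) :
    (stepOp ε p q * pairOp ε p q q' - pairOp ε p q q' * stepOp ε p q) (Finsupp.single L 1) =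
      ∑ r' ∈ Finset.Icc 1 p, ∑ r ∈ Finset.Icc 1 p, ∑ s ∈ Finset.Icc 1 q,
        (pairCoef ε p q q' r s L * coef p q r' (shift ε p r (shift ε q s L)) -
          coef p q r' L * pairCoef ε p q q' r s (shift ε p r' L)) •
          Finsupp.single (shift ε p r' (shift ε p r (shift ε q s L))) 1 := by
  rw [LinearMap.sub_apply, Module.End.mul_apply, Module.End.mul_apply, pairOp_single hpq hpq',
    stepOp_single, map_sum, map_sum]
  have e1 : ∀ r ∈ Finset.Icc 1 p, stepOp ε p q (∑ s ∈ Finset.Icc 1 q,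
      pairCoef ε p q q' r s L • Finsupp.single (shift ε p r (shift ε q s L)) 1) =
      ∑ r' ∈ Finset.Icc 1 p, ∑ s ∈ Finset.Icc 1 q,
        (pairCoef ε p q q' r s L * coef p q r' (shift ε p r (shift ε q s L))) •
          Finsupp.single (shift ε p r' (shift ε p r (shift ε q s L))) 1 := by
    intro r _
    rw [map_sum, Finset.sum_comm]
    refine Finset.sum_congr rfl fun s _ => ?_
    rw [map_smul, stepOp_single, Finset.smul_sum]
    simp only [smul_smul]
  rw [Finset.sum_congr rfl e1, Finset.sum_comm, ← Finset.sum_sub_distrib]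
  refine Finset.sum_congr rfl fun r' _ => ?_
  rw [map_smul, pairOp_single hpq hpq', Finset.smul_sum, ← Finset.sum_sub_distrib]
  refine Finset.sum_congr rfl fun r _ => ?_
  rw [Finset.smul_sum, ← Finset.sum_sub_distrib]
  refine Finset.sum_congr rfl fun s _ => ?_
  rw [smul_smul, sub_smul, shift_comm ε ε q p s r', shift_comm ε ε p p r r']

theorem stepOp_pairOp_single' (hpq : p ≠ q) (hpq' : p ≠ q') (L : ℕ → ℕ → ℤ) :
    (stepOp ε q q' * pairOp ε p q q' - pairOp ε p q q' * stepOp ε q q') (Finsupp.single L 1) =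
      ∑ s' ∈ Finset.Icc 1 q, ∑ s ∈ Finset.Icc 1 q, ∑ r ∈ Finset.Icc 1 p,
        (pairCoef ε p q q' r s L * coef q q' s' (shift ε p r (shift ε q s L)) -
          coef q q' s' L * pairCoef ε p q q' r s (shift ε q s' L)) •
          Finsupp.single (shift ε q s' (shift ε p r (shift ε q s L))) 1 := by
  have e0 : ∀ L, pairOp ε p q q' (Finsupp.single L 1) =
      ∑ s ∈ Finset.Icc 1 q, ∑ r ∈ Finset.Icc 1 p,
        pairCoef ε p q q' r s L • Finsupp.single (shift ε p r (shift ε q s L)) 1 := by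
    intro L
    rw [pairOp_single hpq hpq', Finset.sum_comm]
  rw [LinearMap.sub_apply, Module.End.mul_apply, Module.End.mul_apply, e0, stepOp_single, map_sum,
    map_sum]
  have e1 : ∀ s ∈ Finset.Icc 1 q, stepOp ε q q' (∑ r ∈ Finset.Icc 1 p,
      pairCoef ε p q q' r s L • Finsupp.single (shift ε p r (shift ε q s L)) 1) =
      ∑ s' ∈ Finset.Icc 1 q, ∑ r ∈ Finset.Icc 1 p,
        (pairCoef ε p q q' r s L * coef q q' s' (shift ε p r (shift ε q s L))) •
          Finsupp.single (shift ε q s' (shift ε p r (shift ε q s L))) 1 := by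
    intro s _
    rw [map_sum, Finset.sum_comm]
    refine Finset.sum_congr rfl fun r _ => ?_
    rw [map_smul, stepOp_single, Finset.smul_sum]
    simp only [smul_smul]
  rw [Finset.sum_congr rfl e1, Finset.sum_comm, ← Finset.sum_sub_distrib]
  refine Finset.sum_congr rfl fun s' _ => ?_
  rw [map_smul, e0, Finset.smul_sum, ← Finset.sum_sub_distrib]
  refine Finset.sum_congr rfl fun s _ => ?_
  rw [Finset.smul_sum, ← Finset.sum_sub_distrib]
  refine Finset.sum_congr rfl fun r _ => ?_
  rw [smul_smul, sub_smul, shift_comm ε ε q q s s', shift_comm ε ε p q r s']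

/-- Here `x` and `y` are the distances of the two moving entries of row `p` from the entry of row
`q`; `N / D` and `N' / D'` collect the factors that no step changes. If `D` or `D'` is zero, every
term is zero by convention. -/
theorem serre_left_aux {x y ε g N N' D D' : ℂ} (h0 : x - y ≠ 0) (h1 : x - y - ε ≠ 0)
    (h2 : y - x - ε ≠ 0) :
    -ε * g * (N / ((x - y) * D)) * ((y - ε) * (N' / ((y - x - ε) * D'))) -
        y * (N' / ((y - x) * D')) * (-ε * g * (N / ((x - y - ε) * D))) +
      (-ε * g * (N' / ((y - x) * D')) * ((x - ε) * (N / ((x - y - ε) * D))) -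
        x * (N / ((x - y) * D)) * (-ε * g * (N' / ((y - x - ε) * D')))) = 0 := by
  have h0' : y - x ≠ 0 := by rwa [← neg_sub, neg_ne_zero]
  by_cases hD : D = 0
  · simp [hD]
  by_cases hD' : D' = 0
  · simp [hD']
  field_simp
  ring

/-- The Serre relation in which the row with the link moves twice. -/
theorem trunc_serre_left {B : Set (ℕ → ℕ → ℤ)} (hpq : p ≠ q) (hpq' : p ≠ q')
    (hgap : ∀ L ∈ B, ∀ r' ∈ Finset.Icc 1 p, ∀ r ∈ Finset.Icc 1 p, ∀ s ∈ Finset.Icc 1 q, r ≠ r' →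
      shift ε p r' (shift ε p r (shift ε q s L)) ∈ B → L p r ≠ L p r' ∧ L p r ≠ L p r' + ε) :
    trunc B (stepOp ε p q * pairOp ε p q q' - pairOp ε p q q' * stepOp ε p q) = 0 := by
  refine trunc_eq_zero_of_symm _ _ _ _ (stepOp_pairOp_single hpq hpq')
    (fun r' r s L => shift_comm _ _ _ _ _ _ _) (fun L hL r' hr' r hr s hs hM => ?_)
  -- If one entry moves twice, its term vanishes alone: the linking factor `l_{pr} - l_{qs}` is the
  -- same with both entries shifted as with neither.
  rcases eq_or_ne r r' with rfl | hrr
  · rw [← two_mul]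
    convert mul_zero _
    have e1 : link ((Finset.Icc 1 q).erase s) (shift ε p r L q) (shift ε p r L p r) =
        link ((Finset.Icc 1 q).erase s) (L q) (L p r + ε) := by
      rw [shift_row hpq.symm, shift_self]
    rw [shift_comm, coef_shift_link hs hpq, shift_self, shift_row hpq.symm, coef_eq hs, pairCoef,
      pairCoef, coef_shift hpq.symm hpq'.symm, e1, shift_self]
    push_cast; ring
  · obtain ⟨g1, g2⟩ := hgap L hL r' hr' r hr s hs hrr hM
    -- The gap with the two entries exchanged supplies the third nonzero denominator.
    rw [shift_comm] at hM
    obtain ⟨-, g3⟩ := hgap L hL r hr r' hr' s hs hrr.symm hM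
    have c1 : (L p r : ℂ) - L p r' ≠ 0 := sub_ne_zero.2 (by exact_mod_cast g1)
    have c2 : (L p r : ℂ) - L p r' - ε ≠ 0 := by
      rw [sub_sub]; exact sub_ne_zero.2 (by exact_mod_cast g2)
    have c3 : (L p r' : ℂ) - L p r - ε ≠ 0 := by
      rw [sub_sub]; exact sub_ne_zero.2 (by exact_mod_cast g3)
    have key : ∀ r r', r ∈ Finset.Icc 1 p → r' ∈ Finset.Icc 1 p → r ≠ r' →
        pairCoef ε p q q' r s L = -ε * coef q q' s L *
          (link ((Finset.Icc 1 q).erase s) (L q) (L p r) / (((L p r - L q s : ℂ) - (L p r' - L q s)) *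
            link (((Finset.Icc 1 p).erase r).erase r') (L p) (L p r))) ∧
        pairCoef ε p q q' r s (shift ε p r' L) = -ε * coef q q' s L *
          (link ((Finset.Icc 1 q).erase s) (L q) (L p r) /
            (((L p r - L q s : ℂ) - (L p r' - L q s) - ε) *
            link (((Finset.Icc 1 p).erase r).erase r') (L p) (L p r))) ∧
        coef p q r L = ((L p r : ℂ) - L q s) *
          (link ((Finset.Icc 1 q).erase s) (L q) (L p r) / (((L p r - L q s : ℂ) - (L p r' - L q s)) *
            link (((Finset.Icc 1 p).erase r).erase r') (L p) (L p r))) ∧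
        coef p q r (shift ε p r' (shift ε q s L)) = ((L p r : ℂ) - L q s - ε) *
          (link ((Finset.Icc 1 q).erase s) (L q) (L p r) /
            (((L p r - L q s : ℂ) - (L p r' - L q s) - ε) *
            link (((Finset.Icc 1 p).erase r).erase r') (L p) (L p r))) := by
      intro r r' hr hr' hrr
      have e0 : (L p r - L q s : ℂ) - (L p r' - L q s) = L p r - L p r' := by ring
      have hm : r' ∈ (Finset.Icc 1 p).erase r := Finset.mem_erase.2 ⟨hrr.symm, hr'⟩
      refine ⟨?_, ?_, ?_, ?_⟩
      · rw [pairCoef, link_erase hm, e0]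
      · rw [pairCoef, coef_shift hpq.symm hpq'.symm, link_shift_row hr' hrr, shift_row hpq.symm,
          shift_col hrr, e0]
      · rw [coef_eq hs, link_erase hm, e0]
      · rw [shift_comm, coef_shift_link hs hpq, link_shift_row hr' hrr, shift_row hpq.symm,
          shift_col hrr, e0]
    obtain ⟨k1, k2, k3, k4⟩ := key r r' hr hr' hrr
    obtain ⟨k1', k2', k3', k4'⟩ := key r' r hr' hr hrr.symm
    rw [k1, k2, k3, k4, k1', k2', k3', k4']
    refine serre_left_aux ?_ ?_ ?_
    · rwa [sub_sub_sub_cancel_right]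
    · rwa [sub_sub_sub_cancel_right]
    · rwa [sub_sub_sub_cancel_right]

/-- Here `a` and `b` are the two moving entries of row `q`, and `x` is the entry of row `p` that
moves once. -/
theorem serre_right_aux {x a b ε N V G G' D D' : ℂ} (h0 : a - b ≠ 0) (h1 : a - b - ε ≠ 0)
    (h2 : b - a - ε ≠ 0) :
    -ε * (G / ((a - b) * D)) * ((x - b) * N / V) * (G' / ((b - a - ε) * D')) -
        G' / ((b - a) * D') * (-ε * (G / ((a - b - ε) * D)) * ((x - b - ε) * N / V)) +
      (-ε * (G' / ((b - a) * D')) * ((x - a) * N / V) * (G / ((a - b - ε) * D)) -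
        G / ((a - b) * D) * (-ε * (G' / ((b - a - ε) * D')) * ((x - a - ε) * N / V))) = 0 := by
  have h0' : b - a ≠ 0 := by rwa [← neg_sub, neg_ne_zero]
  by_cases hD : D = 0
  · simp [hD]
  by_cases hD' : D' = 0
  · simp [hD']
  by_cases hV : V = 0
  · simp [hV]
  field_simp
  ring

/-- The Serre relation in which the row without the link moves twice. -/
theorem trunc_serre_right {B : Set (ℕ → ℕ → ℤ)} (hpq : p ≠ q) (hpq' : p ≠ q') (hqq' : q ≠ q')
    (hgap : ∀ L ∈ B, ∀ s' ∈ Finset.Icc 1 q, ∀ s ∈ Finset.Icc 1 q, ∀ r ∈ Finset.Icc 1 p, s ≠ s' →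
      shift ε q s' (shift ε p r (shift ε q s L)) ∈ B → L q s ≠ L q s' ∧ L q s ≠ L q s' + ε) :
    trunc B (stepOp ε q q' * pairOp ε p q q' - pairOp ε p q q' * stepOp ε q q') = 0 := by
  refine trunc_eq_zero_of_symm _ _ _ _ (stepOp_pairOp_single' hpq hpq')
    (fun s' s r L => by rw [shift_comm ε ε p q r s, shift_comm ε ε p q r s',
      shift_comm ε ε q q]) (fun L hL s' hs' s hs r hr hM => ?_)
  rcases eq_or_ne s s' with rfl | hss
  · rw [← two_mul]
    convert mul_zero _
    rw [coef_shift hpq.symm hpq'.symm, pairCoef, pairCoef, shift_row hpq, link_shift_erase]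
    ring
  · obtain ⟨g1, g2⟩ := hgap L hL s' hs' s hs r hr hss hM
    have hM' : shift ε q s (shift ε p r (shift ε q s' L)) ∈ B := by
      rwa [shift_comm ε ε p q r s', shift_comm ε ε q q, ← shift_comm ε ε p q r s]
    obtain ⟨-, g3⟩ := hgap L hL s hs s' hs' r hr hss.symm hM'
    have c1 : (L q s : ℂ) - L q s' ≠ 0 := sub_ne_zero.2 (by exact_mod_cast g1)
    have c2 : (L q s : ℂ) - L q s' - ε ≠ 0 := by
      rw [sub_sub]; exact sub_ne_zero.2 (by exact_mod_cast g2)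
    have c3 : (L q s' : ℂ) - L q s - ε ≠ 0 := by
      rw [sub_sub]; exact sub_ne_zero.2 (by exact_mod_cast g3)
    have key : ∀ s s', s ∈ Finset.Icc 1 q → s' ∈ Finset.Icc 1 q → s ≠ s' →
        pairCoef ε p q q' r s L = -ε *
          (link (Finset.Icc 1 q') (L q') (L q s) / (((L q s : ℂ) - L q s') *
            link (((Finset.Icc 1 q).erase s).erase s') (L q) (L q s))) *
          (((L p r : ℂ) - L q s') * link (((Finset.Icc 1 q).erase s).erase s') (L q) (L p r) /
            link ((Finset.Icc 1 p).erase r) (L p) (L p r)) ∧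
        pairCoef ε p q q' r s (shift ε q s' L) = -ε *
          (link (Finset.Icc 1 q') (L q') (L q s) / (((L q s : ℂ) - L q s' - ε) *
            link (((Finset.Icc 1 q).erase s).erase s') (L q) (L q s))) *
          (((L p r : ℂ) - L q s' - ε) * link (((Finset.Icc 1 q).erase s).erase s') (L q) (L p r) /
            link ((Finset.Icc 1 p).erase r) (L p) (L p r)) ∧
        coef q q' s L =
          link (Finset.Icc 1 q') (L q') (L q s) / (((L q s : ℂ) - L q s') *
            link (((Finset.Icc 1 q).erase s).erase s') (L q) (L q s)) ∧
        coef q q' s (shift ε p r (shift ε q s' L)) =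
          link (Finset.Icc 1 q') (L q') (L q s) / (((L q s : ℂ) - L q s' - ε) *
            link (((Finset.Icc 1 q).erase s).erase s') (L q) (L q s)) := by
      intro s s' hs hs' hss
      have hm : s' ∈ (Finset.Icc 1 q).erase s := Finset.mem_erase.2 ⟨hss.symm, hs'⟩
      refine ⟨?_, ?_, ?_, ?_⟩
      · rw [pairCoef, coef_eq_row hs' hss, link_erase hm (L q) (L p r)]
      · rw [pairCoef, coef_shift_row hqq'.symm hs' hss, shift_row hpq, link_erase hm _ (L p r),
          shift_self, link_congr (b := L q)
            (fun t ht => shift_col (Finset.ne_of_mem_erase ht) _ _ _ _)]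
        push_cast
        rw [sub_sub, sub_sub]
      · rw [coef_eq_row hs' hss]
      · rw [coef_shift hpq.symm hpq'.symm, coef_shift_row hqq'.symm hs' hss]
    obtain ⟨k1, k2, k3, k4⟩ := key s s' hs hs' hss
    obtain ⟨k1', k2', k3', k4'⟩ := key s' s hs' hs hss.symm
    rw [k1, k2, k3, k4, k1', k2', k3', k4', Finset.erase_right_comm (a := s') (b := s)]
    exact serre_right_aux c1 c2 c3

end Serre

end GelfandGraev

namespace GelfandGraev

/-! ### The inequalities as prescribed slots, and adjacent values in a row. -/

section Constraints

/-- The number of entries of row `k + 1` that bound the entry `(k, j)` from above. -/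
def slot (i i' : ℕ → ℕ) (k j : ℕ) : ℕ :=
  if j ≤ i k then j - 1 else if j < i' k then j else j + 1

variable {n : ℕ} {i i' : ℕ → ℕ} {top : Fin n → ℤ}

theorem slot_lt {k j : ℕ} :
    1 ≤ j → i k < i' k → slot i i' k j < slot i i' k (j + 1) := by
  intro hj h
  unfold slot; split_ifs <;> omega

theorem slot_le (k j : ℕ) (hj : j ≤ k) : slot i i' k j ≤ k + 1 := by
  unfold slot; split_ifs <;> omega

theorem slot_succ {k j : ℕ} (hj : 1 ≤ j) (h : i k < i' k) (h1 : j ≠ i k) (h2 : j + 1 ≠ i' k) :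
    slot i i' k (j + 1) = slot i i' k j + 1 := by
  unfold slot; split_ifs <;> omega

theorem slot_succ_of_eq {k j : ℕ} (hj : 1 ≤ j) (h : i k < i' k) (h1 : j = i k ∨ j + 1 = i' k) :
    slot i i' k j + 2 ≤ slot i i' k (j + 1) := by
  unfold slot; split_ifs <;> omega

/-- The slots of row `k` are the numbers `0, …, k + 1` without `i k` and `i' k`; `slot_ne` is the
other half. -/
theorem exists_slot_eq {k j : ℕ} (hj : 1 ≤ j) (hjk : j ≤ k) (hi1 : i k ≤ k) (hi2 : 1 ≤ i' k)
    (h : i k < i' k) (h1 : j ≠ i k) (h2 : j ≠ i' k) : ∃ t, 1 ≤ t ∧ t ≤ k ∧ slot i i' k t = j := by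
  rcases lt_or_ge j (i k) with h3 | h3
  · exact ⟨j + 1, by omega, by omega, by unfold slot; split_ifs <;> omega⟩
  rcases lt_or_ge j (i' k) with h4 | h4
  · exact ⟨j, by omega, by omega, by unfold slot; split_ifs <;> omega⟩
  · exact ⟨j - 1, by omega, by omega, by unfold slot; split_ifs <;> omega⟩

theorem slot_ne {k t : ℕ} (ht : 1 ≤ t) (h : i k < i' k) :
    slot i i' k t ≠ i k ∧ slot i i' k t ≠ i' k := by
  unfold slot; split_ifs <;> omega

theorem SatisfiesGG.row_anti {L : ℕ → ℕ → ℤ} (hi : IsIndexSystem n i i')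
    (h : SatisfiesGG n i i' L) {k j j' : ℕ} (hk : 1 ≤ k) (hkn : k ≤ n) (hj : 1 ≤ j) (hjj : j < j')
    (hj' : j' ≤ k) : L k j' < L k j := by
  induction j', (Nat.succ_le_of_lt hjj) using Nat.le_induction with
  | base => exact h.row_lt hi k j hk hkn hj hj'
  | succ j' hj2 ih =>
    exact (h.row_lt hi k j' hk hkn (by omega) hj').trans (ih (by omega) (by omega))

/-- The Gelfand-Graev inequalities say on which side of which entries of row `k + 1` an entry of
row `k` lies. -/
theorem mem_basisTableaux_iff (hi : IsIndexSystem n i i') (htop : StrictAnti top)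
    {L : ℕ → ℕ → ℤ} : L ∈ basisTableaux n i i' top ↔ IsTableau n L ∧ HasTopRow n top L ∧
      ∀ k j m, 1 ≤ k → k ≤ n - 1 → 1 ≤ j → j ≤ k → 1 ≤ m → m ≤ k + 1 →
        (L k j ≤ L (k + 1) m ↔ m ≤ slot i i' k j) := by
  refine and_congr_right fun hL => and_congr_right fun hT => ⟨fun h => ?_, fun h => ?_⟩
  · intro k j m k1 k2 j1 j2 m1 m2
    have anti : ∀ m m', 1 ≤ m → m ≤ m' → m' ≤ k + 1 → L (k + 1) m' ≤ L (k + 1) m := by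
      intro m m' h1 h2 h3
      rcases h2.lt_or_eq with h2 | rfl
      · exact (h.row_anti hi (by omega) (by omega) h1 h2 h3).le
      · exact le_rfl
    unfold slot
    by_cases p1 : j ≤ i k
    · rw [if_pos p1]
      constructor
      · intro h1
        by_contra h2
        have := h.left_lt k j k1 k2 j1 j2 p1
        have := anti j m j1 (by omega) m2
        omega
      · intro h1
        have := h.left_le k j k1 k2 (by omega) j2 p1
        have := anti m (j - 1) m1 h1 (by omega)
        omega
    · rw [if_neg p1]
      by_cases p2 : j < i' k
      · rw [if_pos p2]
        constructor
        · intro h1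
          by_contra h2
          have := h.mid_lt k j k1 k2 j1 j2 (by omega) p2
          have := anti (j + 1) m (by omega) (by omega) m2
          omega
        · intro h1
          have := h.mid_le k j k1 k2 j1 j2 (by omega) p2
          have := anti m j m1 h1 (by omega)
          omega
      · rw [if_neg p2]
        constructor
        · intro h1
          by_contra h2
          have := h.right_lt k j k1 k2 j1 (by omega) (by omega)
          have := anti (j + 2) m (by omega) (by omega) m2
          omega
        · intro h1
          have := h.right_le k j k1 k2 j1 j2 (by omega)
          have := anti m (j + 1) m1 h1 (by omega)
          omega
  · have key : ∀ k j m, 1 ≤ k → k ≤ n - 1 → 1 ≤ j → j ≤ k → 1 ≤ m → m ≤ k + 1 →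
        slot i i' k j < m → L (k + 1) m < L k j := by
      intro k j m k1 k2 j1 j2 m1 m2 hm
      have := h k j m k1 k2 j1 j2 m1 m2
      omega
    constructor
    · intro j j1 j2
      have e1 := hT ⟨j - 1, by omega⟩
      have e2 := hT ⟨j, by omega⟩
      simp only [Nat.sub_add_cancel j1] at e1 e2
      rw [e1, e2]
      exact htop (by simp only [Fin.lt_def]; omega)
    · intro k j k1 k2 j1 j2 h1
      exact (h k j (j - 1) k1 k2 (by omega) j2 (by omega) (by omega)).2
        (by unfold slot; split_ifs; omega)
    · intro k j k1 k2 j1 j2 h1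
      exact key k j j k1 k2 j1 j2 j1 (by omega) (by unfold slot; split_ifs; omega)
    · intro k j k1 k2 j1 j2 h1 h2
      exact (h k j j k1 k2 j1 j2 j1 (by omega)).2 (by unfold slot; split_ifs <;> omega)
    · intro k j k1 k2 j1 j2 h1 h2
      exact key k j (j + 1) k1 k2 j1 j2 (by omega) (by omega) (by unfold slot; split_ifs <;> omega)
    · intro k j k1 k2 j1 j2 h1
      have := hi k k1 k2
      exact (h k j (j + 1) k1 k2 j1 j2 (by omega) (by omega)).2
        (by unfold slot; split_ifs <;> omega)
    · intro k j k1 k2 j1 j2 h1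
      have := hi k k1 k2
      exact key k j (j + 2) k1 k2 j1 (by omega) (by omega) (by omega)
        (by unfold slot; split_ifs <;> omega)

/-- The preorder on arrays whose intervals are respected by the Gelfand-Tsetlin operators: every
inequality of the type `l_{kj} ≤ l_{k+1,m}` that holds in `L` holds in `M`. -/
structure LinkLE (n : ℕ) (L M : ℕ → ℕ → ℤ) : Prop where
  tableau : IsTableau n L → IsTableau n M
  top : ∀ j, M n j = L n j
  le : ∀ k j m, 1 ≤ k → k ≤ n - 1 → 1 ≤ j → j ≤ k → 1 ≤ m → m ≤ k + 1 →
    L k j ≤ L (k + 1) m → M k j ≤ M (k + 1) m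

theorem LinkLE.refl (n : ℕ) (L : ℕ → ℕ → ℤ) : LinkLE n L L :=
  ⟨id, fun _ => rfl, fun _ _ _ _ _ _ _ _ _ => id⟩

theorem LinkLE.trans (L M N : ℕ → ℕ → ℤ) (h : LinkLE n L M) (h' : LinkLE n M N) :
    LinkLE n L N :=
  ⟨fun hL => h'.tableau (h.tableau hL), fun j => (h'.top j).trans (h.top j),
    fun k j m a b c d e f hl => h'.le k j m a b c d e f (h.le k j m a b c d e f hl)⟩

/-- All basis tableaux satisfy the same inequalities `l_{kj} ≤ l_{k+1,m}`. Along `LinkLE`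
inequalities are only gained, so none can be gained between two basis tableaux. -/
theorem basisTableaux_convex (hi : IsIndexSystem n i i') (htop : StrictAnti top) :
    ∀ L ∈ basisTableaux n i i' top, ∀ M ∈ basisTableaux n i i' top, ∀ N, LinkLE n L N →
      LinkLE n N M → N ∈ basisTableaux n i i' top := by
  intro L hL M hM N h1 h2
  rw [mem_basisTableaux_iff hi htop] at hL hM ⊢
  refine ⟨h1.tableau hL.1, fun j => (h1.top _).trans (hL.2.1 j), ?_⟩
  intro k j m a b c d e f
  exact ⟨fun h => (hM.2.2 k j m a b c d e f).1 (h2.le k j m a b c d e f h),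
    fun h => h1.le k j m a b c d e f ((hL.2.2 k j m a b c d e f).2 h)⟩

/-- The step `ε` in row `p` is coupled with the row `q` by the Gelfand-Tsetlin formulas. -/
def IsLink (ε : ℤ) (p q : ℕ) : Prop := (ε = 1 ∧ q = p + 1) ∨ (ε = -1 ∧ p = q + 1)

/-- A unit step can break an inequality only where it is an equality. Raising endangers the
comparison with the row above, lowering the one with the row below; this is the linked row `q` in
both cases, so equality makes the numerator vanish. -/
theorem linkLE_shift {ε : ℤ} {p q r : ℕ} (hl : IsLink ε p q) (hp : 1 ≤ p) (hpn : p ≤ n - 1)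
    (hr : r ∈ Finset.Icc 1 p) {L : ℕ → ℕ → ℤ} (hc : coef p q r L ≠ 0) :
    LinkLE n L (shift ε p r L) := by
  rw [Finset.mem_Icc] at hr
  have hne : ∀ m, 1 ≤ m → m ≤ q → L p r ≠ L q m := by
    intro m m1 m2 h
    refine hc ?_
    rw [coef, h, link_eq_zero (Finset.mem_Icc.2 ⟨m1, m2⟩), zero_div]
  refine ⟨fun h k j hkj => ?_, fun j => ?_, fun k j m k1 k2 j1 j2 m1 m2 h => ?_⟩
  · rw [shift_apply, h k j hkj, if_neg (by rintro ⟨rfl, rfl⟩; omega)]; rfl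
  · rw [shift_row (by omega)]
  · simp only [shift_apply]
    rcases hl with ⟨rfl, rfl⟩ | ⟨rfl, rfl⟩
    · by_cases h1 : k = p ∧ j = r
      · obtain ⟨rfl, rfl⟩ := h1
        have := hne m m1 m2
        simp only [and_self, if_true]
        split_ifs <;> omega
      · rw [if_neg h1]
        split_ifs <;> omega
    · by_cases h1 : k + 1 = q + 1 ∧ m = r
      · obtain ⟨h1, rfl⟩ := h1
        obtain rfl : k = q := by omega
        have := hne j j1 j2
        simp only [and_self, if_true]
        split_ifs <;> omega
      · rw [if_neg h1]
        split_ifs <;> omega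

theorem stepOp_triangular {ε : ℤ} {p q : ℕ} (hl : IsLink ε p q) (hp : 1 ≤ p) (hpn : p ≤ n - 1) :
    Triangular (LinkLE n) (stepOp ε p q) := by
  intro L M h
  rw [stepOp_single, Finsupp.finsetSum_apply] at h
  obtain ⟨r, hr, h⟩ := Finset.exists_ne_zero_of_sum_ne_zero h
  rw [Finsupp.smul_apply, smul_eq_mul] at h
  have h2 := right_ne_zero_of_mul h
  have : shift ε p r L = M := by
    by_contra hM
    exact h2 (Finsupp.single_eq_of_ne (Ne.symm hM))
  rw [← this]
  exact linkLE_shift hl hp hpn hr (left_ne_zero_of_mul h)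

theorem diagOp_triangular (w : (ℕ → ℕ → ℤ) → ℂ) : Triangular (LinkLE n) (diagOp w) := by
  intro L M h
  rw [diagOp_single, Finsupp.smul_apply, smul_eq_mul] at h
  have : L = M := by
    by_contra hM
    exact right_ne_zero_of_mul h (Finsupp.single_eq_of_ne (Ne.symm hM))
  rw [← this]
  exact LinkLE.refl n L

/-- Between adjacent values in row `k` there is an entry of row `k + 1`. -/
theorem exists_upper_of_adjacent (hi : IsIndexSystem n i i') (htop : StrictAnti top)
    {L : ℕ → ℕ → ℤ} (hL : L ∈ basisTableaux n i i' top) {k j : ℕ} (hkn : k ≤ n - 1)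
    (hj : 1 ≤ j) (hjk : j + 1 ≤ k) (hadj : L k j = L k (j + 1) + 1) :
    (∃ m, 1 ≤ m ∧ m ≤ k + 1 ∧ L (k + 1) m = L k (j + 1)) ∧ j ≠ i k ∧ j + 1 ≠ i' k := by
  have hC := ((mem_basisTableaux_iff hi htop).1 hL).2.2
  have hk := hi k (by omega) hkn
  have s1 := slot_lt (i := i) (i' := i') hj hk.2.2.2
  have s2 := slot_le (i := i) (i' := i') k (j + 1) hjk
  -- The entry `(k + 1, m)` is at least `l_{k,j+1}` and less than `l_{kj}`, so adjacency determines
  -- it.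
  set m := slot i i' k (j + 1) with hm
  have a1 := hC k (j + 1) m (by omega) hkn (by omega) hjk (by omega) s2
  have a2 := hC k j m (by omega) hkn hj (by omega) (by omega) s2
  have e1 : L (k + 1) m = L k (j + 1) := by omega
  refine ⟨⟨m, by omega, s2, e1⟩, ?_⟩
  -- Otherwise the slot between the two is skipped, and `l_{k+1,m-1}` also lies strictly below
  -- `l_{kj}`: there is no room for two values.
  by_contra hcon
  have s3 := slot_succ_of_eq hj hk.2.2.2 (show j = i k ∨ j + 1 = i' k by omega)
  have a3 := hC k j (m - 1) (by omega) hkn hj (by omega) (by omega) (by omega)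
  have a4 := hL.2.2.row_anti hi (k := k + 1) (j := m - 1) (j' := m) (by omega) (by omega)
    (by omega) (by omega) s2
  omega

/-- Between adjacent values in row `k + 1` there is an entry of row `k`, if it has a slot there. -/
theorem exists_lower_of_adjacent (hi : IsIndexSystem n i i') (htop : StrictAnti top)
    {L : ℕ → ℕ → ℤ} (hL : L ∈ basisTableaux n i i' top) {k j : ℕ} (hkn : k ≤ n - 1)
    (hj : 1 ≤ j) (hjk : j ≤ k) (hadj : L (k + 1) j = L (k + 1) (j + 1) + 1)
    (h1 : j ≠ i k) (h2 : j ≠ i' k) : ∃ t, 1 ≤ t ∧ t ≤ k ∧ L k t = L (k + 1) j := by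
  have hC := ((mem_basisTableaux_iff hi htop).1 hL).2.2
  have hk := hi k (by omega) hkn
  obtain ⟨t, t1, t2, ht⟩ := exists_slot_eq hj hjk hk.1 hk.2.1 hk.2.2.2 h1 h2
  have a1 := hC k t j (by omega) hkn t1 t2 hj (by omega)
  have a2 := hC k t (j + 1) (by omega) hkn t1 t2 (by omega) (by omega)
  exact ⟨t, t1, t2, by omega⟩

/-- Under the Lemire-Patera condition there are entries of both neighbouring rows between
adjacent values in a row. -/
theorem LemirePatera.exists_of_adjacent (hi : IsIndexSystem n i i') (htop : StrictAnti top)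
    (hLP : LemirePatera n i i') {L : ℕ → ℕ → ℤ} (hL : L ∈ basisTableaux n i i' top) {k j : ℕ}
    (hkn : k ≤ n - 1) (hj : 1 ≤ j) (hjk : j + 1 ≤ k) (hadj : L k j = L k (j + 1) + 1) :
    (∃ m, 1 ≤ m ∧ m ≤ k + 1 ∧ L (k + 1) m = L k (j + 1)) ∧
      ∃ t, 1 ≤ t ∧ t ≤ k - 1 ∧ L (k - 1) t = L k j := by
  obtain ⟨h1, h2, h3⟩ := exists_upper_of_adjacent hi htop hL hkn hj hjk hadj
  refine ⟨h1, ?_⟩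
  obtain ⟨k, rfl⟩ : ∃ k', k = k' + 1 := ⟨k - 1, by omega⟩
  -- Of the four allowed values, `0` and `k + 1` are out of range for `j`, and the other two are
  -- excluded by adjacency. So interval `j` is not one of the empty ones.
  have h4 := hLP (k + 1) (by omega) hkn
  simp only [Nat.add_sub_cancel, Set.mem_insert_iff, Set.mem_singleton_iff] at h4 ⊢
  have := hi (k + 1) (by omega) hkn
  exact exists_lower_of_adjacent hi htop hL (by omega) hj (by omega) hadj (by omega) (by omega)

/-- The neighbouring row that stays fixed has an entry separating the two values. A joint step by
`ε` carries one of them across it. -/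
theorem LemirePatera.not_adjacent (hi : IsIndexSystem n i i') (htop : StrictAnti top)
    (hLP : LemirePatera n i i') {L M : ℕ → ℕ → ℤ} (hL : L ∈ basisTableaux n i i' top)
    (hM : M ∈ basisTableaux n i i' top) {k j : ℕ} (hkn : k ≤ n - 1) (hj : 1 ≤ j) (hjk : j + 1 ≤ k)
    (hadj : L k j = L k (j + 1) + 1) {ε : ℤ} (hε : ε = 1 ∨ ε = -1) (h1 : M k j = L k j + ε)
    (h2 : M k (j + 1) = L k (j + 1) + ε) (h3 : M (k + 1) = L (k + 1) ∨ M (k - 1) = L (k - 1)) :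
    False := by
  have hC := ((mem_basisTableaux_iff hi htop).1 hL).2.2
  have hC' := ((mem_basisTableaux_iff hi htop).1 hM).2.2
  obtain ⟨⟨m, m1, m2, hm⟩, t, t1, t2, ht⟩ := hLP.exists_of_adjacent hi htop hL hkn hj hjk hadj
  obtain ⟨k, rfl⟩ : ∃ k', k = k' + 1 := ⟨k - 1, by omega⟩
  simp only [Nat.add_sub_cancel] at *
  rcases h3 with h3 | h3
  · have a1 := hC (k + 1) (j + 1) m (by omega) hkn (by omega) hjk m1 m2
    have a2 := hC' (k + 1) (j + 1) m (by omega) hkn (by omega) hjk m1 m2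
    have b1 := hC (k + 1) j m (by omega) hkn hj (by omega) m1 m2
    have b2 := hC' (k + 1) j m (by omega) hkn hj (by omega) m1 m2
    rw [h3] at a2 b2
    omega
  · have a1 := hC k t (j + 1) (by omega) (by omega) t1 t2 (by omega) (by omega)
    have a2 := hC' k t (j + 1) (by omega) (by omega) t1 t2 (by omega) (by omega)
    have b1 := hC k t j (by omega) (by omega) t1 t2 hj (by omega)
    have b2 := hC' k t j (by omega) (by omega) t1 t2 hj (by omega)
    rw [h3] at a2 b2
    omega

/-- Supplies the nonzero denominators for the Serre relations. Values that differ by one sit at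
consecutive positions, and the sign of `ε` decides which comes first. -/
theorem LemirePatera.gap (hi : IsIndexSystem n i i') (htop : StrictAnti top)
    (hLP : LemirePatera n i i') {L M : ℕ → ℕ → ℤ} (hL : L ∈ basisTableaux n i i' top)
    (hM : M ∈ basisTableaux n i i' top) {k r r' : ℕ} (hkn : k ≤ n - 1) (hr : r ∈ Finset.Icc 1 k)
    (hr' : r' ∈ Finset.Icc 1 k) (hrr : r ≠ r') {ε : ℤ} (hε : ε = 1 ∨ ε = -1)
    (h1 : M k r = L k r + ε) (h2 : M k r' = L k r' + ε)
    (h3 : M (k + 1) = L (k + 1) ∨ M (k - 1) = L (k - 1)) :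
    L k r ≠ L k r' ∧ L k r ≠ L k r' + ε := by
  rw [Finset.mem_Icc] at hr hr'
  have anti : ∀ j j', 1 ≤ j → j < j' → j' ≤ k → L k j' < L k j := fun j j' a b c =>
    hL.2.2.row_anti hi (by omega) (by omega) a b c
  have adj : ∀ j j', 1 ≤ j → j ≤ k → 1 ≤ j' → j' ≤ k → L k j = L k j' + 1 → j' = j + 1 := by
    intro j j' j1 j2 j1' j2' h
    rcases lt_trichotomy j j' with h4 | rfl | h4
    · by_contra h5
      have := anti j (j + 1) j1 (by omega) (by omega)
      have := anti (j + 1) j' (by omega) (by omega) j2'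
      omega
    · omega
    · have := anti j' j j1' h4 j2
      omega
  constructor
  · rcases hrr.lt_or_gt with h4 | h4
    · exact (anti r r' hr.1 h4 hr'.2).ne'
    · exact (anti r' r hr'.1 h4 hr.2).ne
  · intro h
    rcases hε with rfl | rfl
    · obtain rfl := adj r r' hr.1 hr.2 hr'.1 hr'.2 h
      exact hLP.not_adjacent hi htop hL hM hkn hr.1 hr'.2 h (Or.inl rfl) h1 h2 h3
    · obtain rfl := adj r' r hr'.1 hr'.2 hr.1 hr.2 (by omega)
      exact hLP.not_adjacent hi htop hL hM hkn hr'.1 hr.2 (by omega) (Or.inr rfl) h2 h1 h3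

end Constraints

end GelfandGraev

namespace GelfandGraev

/-! ### The diagonal part of `[E_{k,k+1}, E_{k+1,k}]` as a sum of residues. -/

section Residues

open Polynomial in
/-- The sum of the residues of the quotient of two monic polynomials of equal degree. -/
theorem sum_residues {ι : Type*} (S : Finset ℤ) (T : Finset ι) (g : ι → ℂ)
    (hcard : T.card = S.card) :
    ∑ x ∈ S, (∏ t ∈ T, ((x : ℂ) - g t)) / ∏ y ∈ S.erase x, ((x : ℂ) - (y : ℂ)) =
      ∑ x ∈ S, (x : ℂ) - ∑ t ∈ T, g t := by
  rcases S.eq_empty_or_nonempty with rfl | hS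
  · simp only [Finset.card_empty, Finset.card_eq_zero] at hcard
    simp [hcard]
  have hpos := hS.card_pos
  -- `P` has degree below `|S|` and agrees with the numerator on `S`. Its coefficient in degree `|S|
  -- - 1` is the left side by Lagrange interpolation and the right side by Vieta.
  set P : ℂ[X] := ∏ t ∈ T, (X - C (g t)) - ∏ x ∈ S, (X - C (x : ℂ)) with hP
  have hinj : Set.InjOn (fun x : ℤ => (x : ℂ)) S := Int.cast_injective.injOn
  have d1 : (∏ t ∈ T, (X - C (g t))).degree = (S.card : WithBot ℕ) := by
    rw [degree_prod]; simp [hcard]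
  have d2 : (∏ x ∈ S, (X - C (x : ℂ))).degree = (S.card : WithBot ℕ) := by
    rw [degree_prod]; simp only [degree_X_sub_C]; simp
  have hdeg : P.degree < S.card := by
    have := degree_sub_lt_left (d1.trans d2.symm)
      (monic_prod_of_monic T _ fun t _ => monic_X_sub_C (g t)).ne_zero (by
        rw [(monic_prod_of_monic T _ fun t _ => monic_X_sub_C (g t)).leadingCoeff,
          (monic_prod_of_monic S _ fun x _ => monic_X_sub_C (x : ℂ)).leadingCoeff])
    rwa [d1] at this
  have h1 := Lagrange.coeff_eq_sum hinj hdeg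
  rw [hP, coeff_sub, prod_X_sub_C_coeff_card_pred S (fun x : ℤ => (x : ℂ)) hpos] at h1
  nth_rewrite 1 [← hcard] at h1
  rw [prod_X_sub_C_coeff_card_pred T g (by omega)] at h1
  rw [show ∑ x ∈ S, (x : ℂ) - ∑ t ∈ T, g t = -∑ t ∈ T, g t - -∑ x ∈ S, (x : ℂ) by ring, h1]
  refine Finset.sum_congr rfl fun x hx => ?_
  congr 1
  rw [eval_sub, eval_prod, eval_prod, Finset.prod_eq_zero hx (by simp)]
  simp

/-- The values in row `k`. -/
def rowSet (k : ℕ) (L : ℕ → ℕ → ℤ) : Finset ℤ := (Finset.Icc 1 k).image (L k)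

/-- The values in row `k` whose successor lies in row `k` as well. -/
def adjSet (k : ℕ) (L : ℕ → ℕ → ℤ) : Finset ℤ :=
  (rowSet k L).filter fun x => x + 1 ∈ rowSet k L

/-- The poles of the commutator in row `k`. -/
def poleSet (k : ℕ) (L : ℕ → ℕ → ℤ) : Finset ℤ := rowSet k L ∪ (rowSet k L).image (· - 1)

/-- The residue of the commutator in row `k` at `x`. -/
noncomputable def residue (k : ℕ) (L : ℕ → ℕ → ℤ) (x : ℤ) : ℂ :=
  ((∏ y ∈ rowSet (k + 1) L \ adjSet k L, ((x : ℂ) - (y : ℂ))) *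
    ∏ y ∈ rowSet (k - 1) L, ((x : ℂ) + 1 - (y : ℂ))) /
      ∏ y ∈ (poleSet k L).erase x, ((x : ℂ) - (y : ℂ))

theorem mem_image_sub_one {s : Finset ℤ} {x : ℤ} : x ∈ s.image (· - 1) ↔ x + 1 ∈ s := by
  rw [Finset.mem_image]
  constructor
  · rintro ⟨y, hy, rfl⟩
    simpa using hy
  · exact fun h => ⟨x + 1, h, by simp⟩

theorem rowSet_inter (k : ℕ) (L : ℕ → ℕ → ℤ) :
    rowSet k L ∩ (rowSet k L).image (· - 1) = adjSet k L := by
  ext x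
  rw [Finset.mem_inter, mem_image_sub_one, adjSet, Finset.mem_filter]

theorem mem_rowSet {k : ℕ} {L : ℕ → ℕ → ℤ} {x : ℤ} :
    x ∈ rowSet k L ↔ ∃ j, 1 ≤ j ∧ j ≤ k ∧ L k j = x := by
  simp [rowSet, and_assoc]

theorem link_eq_prod_rowSet {k : ℕ} {L : ℕ → ℕ → ℤ} (h : Set.InjOn (L k) (Finset.Icc 1 k))
    (x : ℤ) : link (Finset.Icc 1 k) (L k) x = ∏ y ∈ rowSet k L, ((x : ℂ) - (y : ℂ)) := by
  rw [rowSet, Finset.prod_image h]; rfl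

theorem link_erase_eq_prod_rowSet {k r : ℕ} {L : ℕ → ℕ → ℤ}
    (h : Set.InjOn (L k) (Finset.Icc 1 k)) (hr : r ∈ Finset.Icc 1 k) (x : ℤ) :
    link ((Finset.Icc 1 k).erase r) (L k) x =
      ∏ y ∈ (rowSet k L).erase (L k r), ((x : ℂ) - (y : ℂ)) := by
  have e1 : (rowSet k L).erase (L k r) = ((Finset.Icc 1 k).erase r).image (L k) := by
    ext y
    simp only [rowSet, Finset.mem_erase, Finset.mem_image]
    constructor
    · rintro ⟨h1, j, h2, rfl⟩
      exact ⟨j, ⟨fun h3 => h1 (by rw [h3]), h2⟩, rfl⟩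
    · rintro ⟨j, ⟨h1, h2⟩, rfl⟩
      exact ⟨fun h3 => h1 (h h2 hr h3), j, h2, rfl⟩
  rw [e1, Finset.prod_image (h.mono (by simp))]; rfl

variable {k : ℕ} {L : ℕ → ℕ → ℤ}

theorem prod_image_sub_one (s : Finset ℤ) (x : ℤ) :
    ∏ y ∈ s.image (fun z : ℤ => z - 1), ((x : ℂ) - (y : ℂ)) = ∏ y ∈ s, ((x : ℂ) + 1 - (y : ℂ)) := by
  rw [Finset.prod_image (fun a _ b _ h => by simpa using h)]
  refine Finset.prod_congr rfl fun y _ => ?_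
  push_cast; ring

/-- The residue at a simple pole, with the common factors not cancelled. -/
theorem residue_eq {x : ℤ} (hD : adjSet k L ⊆ rowSet (k + 1) L) (hx : x ∉ adjSet k L) :
    residue k L x = ((∏ y ∈ rowSet (k + 1) L, ((x : ℂ) - (y : ℂ))) *
      ∏ y ∈ rowSet (k - 1) L, ((x : ℂ) + 1 - (y : ℂ))) /
      ((∏ y ∈ (rowSet k L).erase x, ((x : ℂ) - (y : ℂ))) *
        ∏ y ∈ ((rowSet k L).image (· - 1)).erase x, ((x : ℂ) - (y : ℂ))) := by
  have e1 : (rowSet k L).erase x ∩ ((rowSet k L).image (· - 1)).erase x =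
      (rowSet k L ∩ (rowSet k L).image (· - 1)).erase x := by
    rw [Finset.erase_inter, Finset.inter_erase, Finset.erase_idem]
  rw [residue, ← Finset.prod_union_inter, ← Finset.erase_union_distrib,
    e1, rowSet_inter, Finset.erase_eq_of_notMem hx,
    ← Finset.prod_sdiff hD, poleSet, mul_right_comm]
  refine (mul_div_mul_right _ _ ?_).symm
  refine Finset.prod_ne_zero_iff.2 fun y hy => sub_ne_zero.2 ?_
  rw [Ne, Int.cast_inj]
  rintro rfl
  exact hx hy

theorem prod_rowSet_eq_zero {x : ℤ} (hD : adjSet k L ⊆ rowSet (k + 1) L) (hx : x ∈ adjSet k L) :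
    ∏ y ∈ rowSet (k + 1) L, ((x : ℂ) - (y : ℂ)) = 0 :=
  Finset.prod_eq_zero (hD hx) (sub_self _)

/-- At a double pole `l_{kr}` also occurs in row `k + 1`, so the raising coefficient vanishes.
Elsewhere the extra factor of the residue's denominator is `l_{kr} + 1 - l_{kr} = 1`. -/
theorem coef_mul_coef_up (h0 : Set.InjOn (L (k - 1)) (Finset.Icc 1 (k - 1)))
    (h1 : Set.InjOn (L k) (Finset.Icc 1 k)) (h2 : Set.InjOn (L (k + 1)) (Finset.Icc 1 (k + 1)))
    (hD : adjSet k L ⊆ rowSet (k + 1) L) {r : ℕ} (hr : r ∈ Finset.Icc 1 k) :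
    coef k (k + 1) r L * coef k (k - 1) r (shift 1 k r L) =
      if L k r ∈ adjSet k L then 0 else residue k L (L k r) := by
  have hk : 1 ≤ k := by rw [Finset.mem_Icc] at hr; omega
  split_ifs with hx
  · rw [coef, link_eq_prod_rowSet h2, prod_rowSet_eq_zero hD hx]; simp
  have hrow : L k r ∈ rowSet k L := Finset.mem_image_of_mem _ hr
  have hx' : L k r ∉ (rowSet k L).image (· - 1) := fun h =>
    hx (by rw [← rowSet_inter]; exact Finset.mem_inter.2 ⟨hrow, h⟩)
  rw [residue_eq hD hx, coef, coef, link_shift_erase, shift_row (by omega), shift_self,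
    link_eq_prod_rowSet h2, link_eq_prod_rowSet h0, link_erase_eq_prod_rowSet h1 hr,
    link_erase_eq_prod_rowSet h1 hr, div_mul_div_comm, Finset.erase_eq_of_notMem hx',
    prod_image_sub_one, ← Finset.mul_prod_erase (rowSet k L) _ hrow]
  push_cast
  simp

/-- Here the pole is `l_{kr} - 1`; the sign is the extra factor `(l_{kr} - 1) - l_{kr}`. -/
theorem coef_mul_coef_down (h0 : Set.InjOn (L (k - 1)) (Finset.Icc 1 (k - 1)))
    (h1 : Set.InjOn (L k) (Finset.Icc 1 k)) (h2 : Set.InjOn (L (k + 1)) (Finset.Icc 1 (k + 1)))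
    (hD : adjSet k L ⊆ rowSet (k + 1) L) {r : ℕ} (hr : r ∈ Finset.Icc 1 k) :
    coef k (k - 1) r L * coef k (k + 1) r (shift (-1) k r L) =
      if L k r - 1 ∈ adjSet k L then 0 else -residue k L (L k r - 1) := by
  have hk : 1 ≤ k := by rw [Finset.mem_Icc] at hr; omega
  have e2 : coef k (k + 1) r (shift (-1) k r L) =
      (∏ y ∈ rowSet (k + 1) L, (((L k r - 1 : ℤ) : ℂ) - (y : ℂ))) /
        ∏ y ∈ (rowSet k L).erase (L k r), (((L k r - 1 : ℤ) : ℂ) - (y : ℂ)) := by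
    rw [coef, link_shift_erase, shift_row (by omega), shift_self, link_eq_prod_rowSet h2,
      link_erase_eq_prod_rowSet h1 hr, ← sub_eq_add_neg]
  split_ifs with hx
  · rw [e2, prod_rowSet_eq_zero hD hx]; simp
  have hrow : L k r ∈ rowSet k L := Finset.mem_image_of_mem _ hr
  have hx2 : L k r - 1 ∉ rowSet k L := fun h =>
    hx (by rw [adjSet, Finset.mem_filter]; exact ⟨h, by simpa using hrow⟩)
  have e3 : ((rowSet k L).image (· - 1)).erase (L k r - 1) =
      ((rowSet k L).erase (L k r)).image (· - 1) := by
    rw [Finset.image_erase (fun a b h => by simpa using h)]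
  rw [e2, residue_eq hD hx, e3, Finset.erase_eq_of_notMem hx2, prod_image_sub_one,
    ← Finset.mul_prod_erase (rowSet k L) (fun y => (((L k r - 1 : ℤ) : ℂ) - (y : ℂ))) hrow, coef,
    link_eq_prod_rowSet h0, link_erase_eq_prod_rowSet h1 hr]
  have c1 : ((L k r - 1 : ℤ) : ℂ) - (L k r : ℂ) = -1 := by push_cast; ring
  have c2 : ((L k r - 1 : ℤ) : ℂ) + 1 = (L k r : ℂ) := by push_cast; ring
  rw [c1, c2, div_mul_div_comm, neg_one_mul, neg_mul, div_neg, neg_neg, mul_comm]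
  congr 1
  exact mul_comm _ _

theorem sum_rowSet (h : Set.InjOn (L k) (Finset.Icc 1 k)) :
    ∑ x ∈ rowSet k L, (x : ℂ) = ∑ j ∈ Finset.Icc 1 k, (L k j : ℂ) := by
  rw [rowSet, Finset.sum_image h]

theorem card_rowSet (h : Set.InjOn (L k) (Finset.Icc 1 k)) : (rowSet k L).card = k := by
  rw [rowSet, Finset.card_image_of_injOn h]; simp

theorem sum_residue (hk : 1 ≤ k) (h0 : Set.InjOn (L (k - 1)) (Finset.Icc 1 (k - 1)))
    (h1 : Set.InjOn (L k) (Finset.Icc 1 k)) (h2 : Set.InjOn (L (k + 1)) (Finset.Icc 1 (k + 1)))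
    (hD : adjSet k L ⊆ rowSet (k + 1) L) :
    ∑ x ∈ poleSet k L, residue k L x = weight k L - weight (k + 1) L := by
  have hcardS : (poleSet k L).card + (adjSet k L).card = k + k := by
    have := Finset.card_union_add_card_inter (rowSet k L) ((rowSet k L).image (· - 1))
    rw [rowSet_inter, Finset.card_image_of_injective _ (fun a b h => by simpa using h),
      card_rowSet h1] at this
    exact this
  have hcardT : (rowSet (k + 1) L \ adjSet k L).card + (adjSet k L).card = k + 1 := by
    rw [Finset.card_sdiff_add_card_eq_card hD, card_rowSet h2]
  -- The zeros of the numerator are the values of row `k + 1` left after cancelling the double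
  -- poles, and those of row `k - 1` lowered by one.
  have key := sum_residues (poleSet k L)
    ((rowSet (k + 1) L \ adjSet k L).disjSum (rowSet (k - 1) L))
    (Sum.elim (fun y => (y : ℂ)) fun y => (y : ℂ) - 1) (by
      rw [Finset.card_disjSum, card_rowSet h0]; omega)
  simp only [Finset.prod_disjSum, Finset.sum_disjSum, Sum.elim_inl, Sum.elim_inr] at key
  have e1 : ∀ x ∈ poleSet k L, residue k L x =
      ((∏ y ∈ rowSet (k + 1) L \ adjSet k L, ((x : ℂ) - (y : ℂ))) *
        ∏ y ∈ rowSet (k - 1) L, ((x : ℂ) - ((y : ℂ) - 1))) /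
        ∏ y ∈ (poleSet k L).erase x, ((x : ℂ) - (y : ℂ)) := by
    intro x _
    rw [residue]
    congr 2
    exact Finset.prod_congr rfl fun y _ => by ring
  rw [Finset.sum_congr rfl e1, key, Finset.sum_sub_distrib, sum_rowSet h0]
  have s1 : ∑ x ∈ poleSet k L, (x : ℂ) + ∑ x ∈ adjSet k L, (x : ℂ) =
      ∑ j ∈ Finset.Icc 1 k, (L k j : ℂ) + (∑ j ∈ Finset.Icc 1 k, (L k j : ℂ) - k) := by
    rw [poleSet, ← rowSet_inter, Finset.sum_union_inter, sum_rowSet h1,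
      Finset.sum_image (fun a _ b _ h => by simpa using h)]
    push_cast
    rw [Finset.sum_sub_distrib, sum_rowSet h1]
    simp [card_rowSet h1]
  have s2 := Finset.sum_sdiff (f := fun x : ℤ => (x : ℂ)) hD
  rw [sum_rowSet h2] at s2
  have s3 : ∑ x ∈ rowSet (k - 1) L, (1 : ℂ) = k - 1 := by
    rw [Finset.sum_const, card_rowSet h0, nsmul_one, Nat.cast_sub hk, Nat.cast_one]
  rw [s3, weight, weight, Nat.add_sub_cancel]
  push_cast
  linear_combination s1 - s2

/-- The diagonal part of the commutator in row `k`, up to the residues at the double poles. -/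
theorem sum_coef_mul_coef (hk : 1 ≤ k) (h0 : Set.InjOn (L (k - 1)) (Finset.Icc 1 (k - 1)))
    (h1 : Set.InjOn (L k) (Finset.Icc 1 k)) (h2 : Set.InjOn (L (k + 1)) (Finset.Icc 1 (k + 1)))
    (hD : adjSet k L ⊆ rowSet (k + 1) L) :
    ∑ r ∈ Finset.Icc 1 k, (coef k (k - 1) r L * coef k (k + 1) r (shift (-1) k r L) -
          coef k (k + 1) r L * coef k (k - 1) r (shift 1 k r L)) =
      ∑ x ∈ adjSet k L, residue k L x - (weight k L - weight (k + 1) L) := by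
  have e1 : ∑ r ∈ Finset.Icc 1 k, coef k (k + 1) r L * coef k (k - 1) r (shift 1 k r L) =
      ∑ x ∈ rowSet k L \ adjSet k L, residue k L x := by
    rw [Finset.sum_congr rfl fun r hr => coef_mul_coef_up h0 h1 h2 hD hr, Finset.sdiff_eq_filter,
      Finset.sum_filter, rowSet, Finset.sum_image h1]
    simp only [ite_not]
  have e2 : ∑ r ∈ Finset.Icc 1 k, coef k (k - 1) r L * coef k (k + 1) r (shift (-1) k r L) =
      -∑ x ∈ (rowSet k L).image (· - 1) \ adjSet k L, residue k L x := by
    rw [Finset.sum_congr rfl fun r hr => coef_mul_coef_down h0 h1 h2 hD hr, Finset.sdiff_eq_filter,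
      Finset.sum_filter, Finset.sum_image (fun a _ b _ h => by simpa using h), rowSet,
      Finset.sum_image h1, ← Finset.sum_neg_distrib]
    refine Finset.sum_congr rfl fun r _ => ?_
    split_ifs <;> simp_all
  -- The poles split into those seen by raising first, those seen by lowering first, and the double
  -- poles, which neither product sees.
  have e3 : poleSet k L = (rowSet k L \ adjSet k L) ∪
      ((rowSet k L).image (· - 1) \ adjSet k L) ∪ adjSet k L := by
    rw [← rowSet_inter, poleSet]
    ext x
    simp only [Finset.mem_union, Finset.mem_sdiff, Finset.mem_inter]
    tauto
  rw [Finset.sum_sub_distrib, e1, e2, ← sum_residue hk h0 h1 h2 hD, e3, Finset.sum_union,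
    Finset.sum_union]
  · ring
  · rw [Finset.disjoint_left, ← rowSet_inter]
    simp only [Finset.mem_sdiff, Finset.mem_inter]
    tauto
  · rw [Finset.disjoint_left]
    simp only [Finset.mem_union, Finset.mem_sdiff]
    tauto

end Residues

end GelfandGraev

namespace GelfandGraev

/-! ### The relations after compression, and sufficiency of the Lemire-Patera condition. -/

section Commutators

variable {n : ℕ} {i i' : ℕ → ℕ} {top : Fin n → ℤ} {L : ℕ → ℕ → ℤ} {k : ℕ}

theorem injOn_row (hi : IsIndexSystem n i i') (hL : L ∈ basisTableaux n i i' top) (hk : k ≤ n) :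
    Set.InjOn (L k) (Finset.Icc 1 k) := by
  intro a ha b hb hab
  simp only [Finset.coe_Icc, Set.mem_Icc] at ha hb
  rcases lt_trichotomy a b with h | h | h
  · have := hL.2.2.row_anti hi (by omega) hk ha.1 h hb.2
    omega
  · exact h
  · have := hL.2.2.row_anti hi (by omega) hk hb.1 h ha.2
    omega

theorem exists_of_mem_adjSet (hi : IsIndexSystem n i i') (hL : L ∈ basisTableaux n i i' top)
    (hk : k ≤ n) {x : ℤ} (hx : x ∈ adjSet k L) :
    ∃ j, 1 ≤ j ∧ j + 1 ≤ k ∧ L k (j + 1) = x ∧ L k j = x + 1 := by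
  rw [adjSet, Finset.mem_filter, mem_rowSet, mem_rowSet] at hx
  obtain ⟨⟨a, a1, a2, ha⟩, b, b1, b2, hb⟩ := hx
  have hba : b < a := by
    by_contra h
    rcases (not_lt.1 h).lt_or_eq with h | h
    · have := hL.2.2.row_anti hi (by omega) hk a1 h b2
      omega
    · subst h; omega
  have e : a = b + 1 := by
    by_contra h
    have := hL.2.2.row_anti hi (j := b) (j' := b + 1) (by omega) hk b1 (by omega) (by omega)
    have := hL.2.2.row_anti hi (j := b + 1) (j' := a) (by omega) hk (by omega) (by omega) a2
    omega
  subst e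
  exact ⟨b, b1, a2, ha, hb⟩

/-- Holds for all index pairs: it reduces the double poles to simple ones without the Lemire-Patera
condition, as necessity requires. -/
theorem adjSet_subset (hi : IsIndexSystem n i i') (htop : StrictAnti top)
    (hL : L ∈ basisTableaux n i i' top) (hkn : k ≤ n - 1) : adjSet k L ⊆ rowSet (k + 1) L := by
  intro x hx
  obtain ⟨j, j1, j2, h1, h2⟩ := exists_of_mem_adjSet hi hL (by omega) hx
  obtain ⟨⟨m, m1, m2, hm⟩, -⟩ :=
    exists_upper_of_adjacent hi htop hL hkn j1 j2 (by rw [h1, h2])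
  exact mem_rowSet.2 ⟨m, m1, m2, hm.trans h1⟩

/-- The diagonal part of the commutator in row `k` of a basis tableau. -/
theorem diagonal_eq (hi : IsIndexSystem n i i') (htop : StrictAnti top)
    (hL : L ∈ basisTableaux n i i' top) (hk : 1 ≤ k) (hkn : k ≤ n - 1) :
    ∑ r ∈ Finset.Icc 1 k, (coef k (k - 1) r L * coef k (k + 1) r (shift (-1) k r L) -
          coef k (k + 1) r L * coef k (k - 1) r (shift 1 k r L)) =
      ∑ x ∈ adjSet k L, residue k L x - (weight k L - weight (k + 1) L) :=
  sum_coef_mul_coef hk (injOn_row hi hL (by omega)) (injOn_row hi hL (by omega))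
    (injOn_row hi hL (by omega)) (adjSet_subset hi htop hL hkn)

theorem residue_eq_zero {x : ℤ} {t : ℕ} (h1 : 1 ≤ t) (h2 : t ≤ k - 1) (h : L (k - 1) t = x + 1) :
    residue k L x = 0 := by
  rw [residue, Finset.prod_eq_zero (mem_rowSet.2 ⟨t, h1, h2, h⟩) (by push_cast; ring)]
  simp

/-- Row `k - 1` contains the larger value `x + 1` of the adjacent pair, which is a zero of the
numerator. -/
theorem LemirePatera.residue_eq_zero (hi : IsIndexSystem n i i') (htop : StrictAnti top)
    (hLP : LemirePatera n i i') (hL : L ∈ basisTableaux n i i' top) (hkn : k ≤ n - 1)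
    {x : ℤ} (hx : x ∈ adjSet k L) : residue k L x = 0 := by
  obtain ⟨j, j1, j2, h1, h2⟩ := exists_of_mem_adjSet hi hL (by omega) hx
  obtain ⟨-, t, t1, t2, ht⟩ :=
    hLP.exists_of_adjacent hi htop hL hkn j1 j2 (by rw [h1, h2])
  exact GelfandGraev.residue_eq_zero t1 t2 (ht.trans h2)

theorem isLink_up (k : ℕ) : IsLink 1 k (k + 1) := Or.inl ⟨rfl, rfl⟩

theorem isLink_down (hk : 1 ≤ k) : IsLink (-1) k (k - 1) := Or.inr ⟨rfl, by omega⟩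

/-- Compression discards exactly the labels at which `T` is zero by convention. -/
theorem trunc_stepOp_apply_T (ε : ℤ) (p q : ℕ) (hL : L ∈ basisTableaux n i i' top) :
    trunc (basisTableaux n i i' top) (stepOp ε p q) (T n i i' top L) =
      ∑ r ∈ Finset.Icc 1 p, coef p q r L • T n i i' top (shift ε p r L) := by
  have hT : ∀ M, Finsupp.lsubtypeDomain (M := ℂ) (R := ℂ) (basisTableaux n i i' top)
      (Finsupp.single M 1) = T n i i' top M := by
    intro M
    ext N
    rw [T, Finsupp.lsubtypeDomain_apply, Finsupp.subtypeDomain_apply]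
    split_ifs with hM
    · rw [← Finsupp.single_apply_left Subtype.val_injective (⟨M, hM⟩ : basisTableaux n i i' top)]
    · rw [Finsupp.single_eq_of_ne (fun h : N.1 = M => hM (h ▸ N.2))]; rfl
  have hTL : T n i i' top L = Finsupp.single ⟨L, hL⟩ 1 := dif_pos hL
  rw [hTL, trunc, LinearMap.comp_apply, LinearMap.comp_apply, Finsupp.lmapDomain_apply,
    Finsupp.mapDomain_single, stepOp_single, map_sum]
  exact Finset.sum_congr rfl fun r _ => by rw [map_smul, hT]

theorem trunc_diagOp_apply_T (w : (ℕ → ℕ → ℤ) → ℂ) (hL : L ∈ basisTableaux n i i' top) :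
    trunc (basisTableaux n i i' top) (diagOp w) (T n i i' top L) = w L • T n i i' top L := by
  have hTL : T n i i' top L = Finsupp.single ⟨L, hL⟩ 1 := dif_pos hL
  ext N
  rw [hTL, trunc_single, diagOp_single, Finsupp.smul_apply, Finsupp.smul_apply,
    ← Finsupp.single_apply_left Subtype.val_injective (⟨L, hL⟩ : basisTableaux n i i' top)]

theorem trunc_diagOp_congr {w w' : (ℕ → ℕ → ℤ) → ℂ}
    (h : ∀ L ∈ basisTableaux n i i' top, w L = w' L) :
    trunc (basisTableaux n i i' top) (diagOp w) = trunc (basisTableaux n i i' top) (diagOp w') := by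
  refine Finsupp.lhom_ext' fun L => LinearMap.ext_ring (Finsupp.ext fun M => ?_)
  simp only [LinearMap.comp_apply, Finsupp.lsingle_apply]
  rw [trunc_single, trunc_single, diagOp_single, diagOp_single, h L L.2]

theorem trunc_commutator (hi : IsIndexSystem n i i') (htop : StrictAnti top)
    {A A' : Module.End ℂ ((ℕ → ℕ → ℤ) →₀ ℂ)} (hA : Triangular (LinkLE n) A)
    (hA' : Triangular (LinkLE n) A') :
    trunc (basisTableaux n i i' top) A * trunc (basisTableaux n i i' top) A' -
        trunc (basisTableaux n i i' top) A' * trunc (basisTableaux n i i' top) A =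
      trunc (basisTableaux n i i' top) (A * A' - A' * A) := by
  have hB := basisTableaux_convex hi htop
  rw [trunc_sub, trunc_mul hB hA hA', trunc_mul hB hA' hA]

/-- The compression of the commutator in row `k`. -/
theorem commutator_row (hi : IsIndexSystem n i i') (htop : StrictAnti top) (hk : 1 ≤ k)
    (hkn : k ≤ n - 1) :
    trunc (basisTableaux n i i' top) (stepOp 1 k (k + 1)) *
        trunc (basisTableaux n i i' top) (stepOp (-1) k (k - 1)) -
      trunc (basisTableaux n i i' top) (stepOp (-1) k (k - 1)) *
        trunc (basisTableaux n i i' top) (stepOp 1 k (k + 1)) =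
      trunc (basisTableaux n i i' top) (diagOp fun L =>
        ∑ x ∈ adjSet k L, residue k L x - (weight k L - weight (k + 1) L)) := by
  rw [trunc_commutator hi htop (stepOp_triangular (isLink_up k) hk hkn)
    (stepOp_triangular (isLink_down hk) hk hkn), stepOp_commutator_diag (by omega) (by omega)]
  exact trunc_diagOp_congr fun L hL => diagonal_eq hi htop hL hk hkn

/-- In a Serre relation only the rows `u` and `w` move, so the neighbour of row `u` other than `w`
is fixed, as `LemirePatera.gap` needs. -/
theorem LemirePatera.gap_linked (hi : IsIndexSystem n i i') (htop : StrictAnti top)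
    (hLP : LemirePatera n i i') {ε : ℤ} {u w : ℕ} (hε : ε = 1 ∨ ε = -1) (hu : 1 ≤ u)
    (hun : u ≤ n - 1) (huw : u = w + 1 ∨ w = u + 1) (hL : L ∈ basisTableaux n i i' top)
    {M : ℕ → ℕ → ℤ} (hM : M ∈ basisTableaux n i i' top) {r r' s : ℕ}
    (hr : r ∈ Finset.Icc 1 u) (hr' : r' ∈ Finset.Icc 1 u) (hrr : r ≠ r')
    (h : M = shift ε u r' (shift ε u r (shift ε w s L))) :
    L u r ≠ L u r' ∧ L u r ≠ L u r' + ε := by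
  have huw' : u ≠ w := by omega
  refine hLP.gap hi htop hL hM hun hr hr' hrr hε ?_ ?_ ?_
  · rw [h, shift_col hrr, shift_self, shift_row huw']
  · rw [h, shift_self, shift_col hrr.symm, shift_row huw']
  · rcases huw with huw | huw
    · left
      rw [h, shift_row (by omega), shift_row (by omega), shift_row (by omega)]
    · right
      rw [h, shift_row (by omega), shift_row (by omega), shift_row (by omega)]

attribute [local instance 100] LieRing.ofAssociativeRing

/-- The Chevalley-Serre relations in an associative algebra, for the raising operators `-x k`. -/
theorem ChevalleyRelations.of_commutators {A : Type*} [Ring A] [Algebra ℂ A] {n : ℕ}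
    {h x y : ℕ → A}
    (hh : ∀ a b, h a * h b - h b * h a = 0)
    (hx : ∀ a k, 1 ≤ a → 1 ≤ k → k < n →
      h a * x k - x k * h a = (kron a k - kron a (k + 1)) • x k)
    (hy : ∀ a k, 1 ≤ a → 1 ≤ k → k < n →
      h a * y k - y k * h a = (kron a (k + 1) - kron a k) • y k)
    (xy : ∀ k, 1 ≤ k → k < n → x k * y k - y k * x k = -(h k - h (k + 1)))
    (xy_ne : ∀ k l, 1 ≤ k → k < n → 1 ≤ l → l < n → k ≠ l → x k * y l - y l * x k = 0)
    (xx : ∀ k l, 1 ≤ k → k + 2 ≤ l → l < n → x k * x l - x l * x k = 0)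
    (yy : ∀ k l, 1 ≤ k → k + 2 ≤ l → l < n → y k * y l - y l * y k = 0)
    (xxx : ∀ k, 1 ≤ k → k + 1 < n →
      x k * (x k * x (k + 1) - x (k + 1) * x k) - (x k * x (k + 1) - x (k + 1) * x k) * x k = 0 ∧
      x (k + 1) * (x k * x (k + 1) - x (k + 1) * x k) -
        (x k * x (k + 1) - x (k + 1) * x k) * x (k + 1) = 0)
    (yyy : ∀ k, 1 ≤ k → k + 1 < n →
      y k * (y (k + 1) * y k - y k * y (k + 1)) - (y (k + 1) * y k - y k * y (k + 1)) * y k = 0 ∧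
      y (k + 1) * (y (k + 1) * y k - y k * y (k + 1)) -
        (y (k + 1) * y k - y k * y (k + 1)) * y (k + 1) = 0) :
    ChevalleyRelations n h (fun k => -x k) y := by
  simp only [← Ring.lie_def] at *
  have skew : ∀ u v : A, ⁅u, v⁆ = 0 → ⁅v, u⁆ = 0 := fun u v h => by rw [← lie_skew, h, neg_zero]
  refine ⟨fun a b _ _ _ _ => hh a b, fun a k a1 _ k1 k2 => ?_,
    fun a k a1 _ k1 k2 => hy a k a1 k1 k2, fun k k1 k2 => ?_, fun k l k1 k2 l1 l2 hkl => ?_,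
    fun k l k1 k2 l2 => ?_, yy, fun k k1 k2 => ?_, fun k k1 k2 => ?_, fun k k1 k2 => ?_,
    fun k k1 k2 => ?_⟩
  · rw [lie_neg, hx a k a1 k1 k2, smul_neg]
  · rw [neg_lie, xy k k1 k2, neg_neg]
  · rw [neg_lie, xy_ne k l k1 k2 l1 l2 hkl, neg_zero]
  · rw [neg_lie, lie_neg, xx k l k1 k2 l2, neg_zero, neg_zero]
  · simp only [neg_lie, lie_neg, (xxx k k1 k2).1, neg_zero]
  · simp only [neg_lie, lie_neg, skew _ _ (xxx k k1 k2).2, neg_zero]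
  · rw [← lie_skew (y k) (y (k + 1)), lie_neg, (yyy k k1 k2).1, neg_zero]
  · rw [← lie_skew (y k) (y (k + 1)), neg_lie, skew _ _ (yyy k k1 k2).2, neg_zero]

/-- The Lemire-Patera condition enters only in the relation `ef`, through the residues, and in the
Serre relations, through the gaps. -/
theorem LemirePatera.chevalleyRelations (hi : IsIndexSystem n i i') (htop : StrictAnti top)
    (hLP : LemirePatera n i i') :
    ChevalleyRelations n (fun k => trunc (basisTableaux n i i' top) (diagOp (weight k)))
      (fun k => -trunc (basisTableaux n i i' top) (stepOp 1 k (k + 1)))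
      (fun k => trunc (basisTableaux n i i' top) (stepOp (-1) k (k - 1))) := by
  have up : ∀ k, 1 ≤ k → k < n → Triangular (LinkLE n) (stepOp 1 k (k + 1)) :=
    fun k h1 h2 => stepOp_triangular (isLink_up k) h1 (by omega)
  have down : ∀ k, 1 ≤ k → k < n → Triangular (LinkLE n) (stepOp (-1) k (k - 1)) :=
    fun k h1 h2 => stepOp_triangular (isLink_down h1) h1 (by omega)
  have pair_up : ∀ k, 1 ≤ k → k + 1 < n →
      Triangular (LinkLE n) (pairOp 1 k (k + 1) (k + 1 + 1)) := fun k h1 h2 =>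
    ((up k h1 (by omega)).mul LinkLE.trans (up (k + 1) (by omega) h2)).sub
      ((up (k + 1) (by omega) h2).mul LinkLE.trans (up k h1 (by omega)))
  have pair_down : ∀ k, 1 ≤ k → k + 1 < n →
      Triangular (LinkLE n) (pairOp (-1) (k + 1) k (k - 1)) := fun k h1 h2 =>
    ((down (k + 1) (by omega) h2).mul LinkLE.trans (down k h1 (by omega))).sub
      ((down k h1 (by omega)).mul LinkLE.trans (down (k + 1) (by omega) h2))
  refine ChevalleyRelations.of_commutators
    (A := Module.End ℂ (H n i i' top)) ?_ ?_ ?_ ?_ ?_ ?_ ?_ ?_ ?_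
  · intro a b
    rw [trunc_commutator hi htop (diagOp_triangular _) (diagOp_triangular _), diagOp_commute,
      trunc_zero]
  · intro a k a1 k1 k2
    rw [trunc_commutator hi htop (diagOp_triangular _) (up k k1 k2),
      diagOp_commutator fun L r hr => weight_shift a1 hr 1 L, trunc_smul]
    push_cast; rw [one_mul]
  · intro a k a1 k1 k2
    rw [trunc_commutator hi htop (diagOp_triangular _) (down k k1 k2),
      diagOp_commutator fun L r hr => weight_shift a1 hr (-1) L, trunc_smul]
    push_cast; rw [neg_one_mul, neg_sub]
  · intro k k1 k2
    rw [commutator_row hi htop k1 (by omega)]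
    refine Finsupp.lhom_ext' fun L => LinearMap.ext_ring (Finsupp.ext fun M => ?_)
    simp only [LinearMap.comp_apply, Finsupp.lsingle_apply, LinearMap.neg_apply,
      LinearMap.sub_apply, Finsupp.neg_apply, Finsupp.sub_apply]
    rw [trunc_single, trunc_single, trunc_single, diagOp_single, diagOp_single, diagOp_single,
      Finset.sum_eq_zero fun x hx => hLP.residue_eq_zero hi htop L.2 (by omega) hx]
    simp only [Finsupp.smul_apply, smul_eq_mul]
    ring
  · intro k l k1 k2 l1 l2 hkl
    rw [trunc_commutator hi htop (up k k1 k2) (down l l1 l2)]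
    by_cases h : l = k + 1
    · subst h
      rw [Nat.add_sub_cancel, stepOp_commute_opposite 1 (by omega), trunc_zero]
    · rw [stepOp_commute_of_ne hkl (by omega) h, trunc_zero]
  · intro k l k1 k2 l2
    rw [trunc_commutator hi htop (up k k1 (by omega)) (up l (by omega) l2),
      stepOp_commute_of_ne (by omega) (by omega) (by omega), trunc_zero]
  · intro k l k1 k2 l2
    rw [trunc_commutator hi htop (down k k1 (by omega)) (down l (by omega) l2),
      stepOp_commute_of_ne (by omega) (by omega) (by omega), trunc_zero]
  · intro k k1 k2
    have u1 := up k k1 (by omega)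
    have u2 := up (k + 1) (by omega) k2
    rw [trunc_commutator hi htop u1 u2]
    constructor
    · refine (trunc_commutator hi htop u1 (pair_up k k1 k2)).trans ?_
      exact trunc_serre_left (by omega) (by omega)
        fun L hL r' hr' r hr s _ hrr hM => hLP.gap_linked hi htop (Or.inl rfl) k1 (by omega)
          (Or.inr rfl) hL hM hr hr' hrr rfl
    · refine (trunc_commutator hi htop u2 (pair_up k k1 k2)).trans ?_
      exact trunc_serre_right (by omega) (by omega) (by omega)
        fun L hL r' hr' r hr s _ hrr hM => hLP.gap_linked hi htop (Or.inl rfl) (by omega)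
          (by omega) (Or.inl rfl) hL hM hr hr' hrr (by rw [shift_comm 1 1 k (k + 1) s r])
  · intro k k1 k2
    have u1 := down k k1 (by omega)
    have u2 := down (k + 1) (by omega) k2
    rw [trunc_commutator hi htop u2 u1]
    constructor
    · refine (trunc_commutator hi htop u1 (pair_down k k1 k2)).trans ?_
      exact trunc_serre_right (by omega) (by omega) (by omega)
        fun L hL r' hr' r hr s _ hrr hM => hLP.gap_linked hi htop (Or.inr rfl) k1 (by omega)
          (Or.inr rfl) hL hM hr hr' hrr (by rw [shift_comm (-1) (-1) (k + 1) k s r])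
    · refine (trunc_commutator hi htop u2 (pair_down k k1 k2)).trans ?_
      exact trunc_serre_left (by omega) (by omega)
        fun L hL r' hr' r hr s _ hrr hM => hLP.gap_linked hi htop (Or.inr rfl) (by omega)
          (by omega) (Or.inl rfl) hL hM hr hr' hrr rfl

/-- The Lemire-Patera condition is sufficient. -/
theorem LemirePatera.definesModule (hn : 1 ≤ n) (hi : IsIndexSystem n i i')
    (htop : StrictAnti top) (hLP : LemirePatera n i i') : DefinesModule n i i' top := by
  have R := hLP.chevalleyRelations hi htop
  obtain ⟨ρ, hρ⟩ := (R.matrixRelations hn le_rfl).exists_lieHom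
  refine ⟨ρ, fun L hL k k1 k2 => ?_, fun L hL k k1 k2 => ?_, fun L hL k k1 k2 => ?_⟩
  · rw [hρ k (k + 1) k1 (by omega) (by omega) (by omega), R.root_succ k1 (by omega),
      LinearMap.neg_apply, trunc_stepOp_apply_T 1 k (k + 1) hL, ← Finset.sum_neg_distrib]
    refine Finset.sum_congr rfl fun r _ => ?_
    rw [eCoeff_eq, neg_smul, shift, one_smul]
  · rw [hρ (k + 1) k (by omega) (by omega) k1 (by omega), R.root_pred k1 (by omega),
      trunc_stepOp_apply_T (-1) k (k - 1) hL]
    refine Finset.sum_congr rfl fun r _ => ?_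
    rw [fCoeff_eq, shift, neg_one_smul, sub_eq_add_neg]
  · rw [hρ k k k1 k2 k1 k2, root_self, trunc_diagOp_apply_T _ hL]

end Commutators

end GelfandGraev

namespace GelfandGraev

/-! ### Necessity: tableaux with adjacent values around an empty interval. -/

section Necessity

variable {n : ℕ} {i i' : ℕ → ℕ} {top : Fin n → ℤ} {L : ℕ → ℕ → ℤ} {k : ℕ}

attribute [local instance 100] LieRing.ofAssociativeRing

theorem E_lie_E (hk : 1 ≤ k) (hkn : k < n) :
    ⁅E n k (k + 1), E n (k + 1) k⁆ = E n k k - E n (k + 1) (k + 1) := by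
  have hmul : ∀ a b, 1 ≤ b → b ≤ n → E n a b * E n b a = E n a a := by
    intro a b b1 b2
    ext p q
    rw [Matrix.mul_apply, Finset.sum_eq_single ⟨b - 1, by omega⟩]
    · simp only [E, Matrix.of_apply, Nat.sub_add_cancel b1]
      split_ifs <;> simp_all
    · intro r _ hr
      have : r.val + 1 ≠ b := fun h => hr (Fin.ext (by simp; omega))
      simp [E, this]
    · simp
  rw [Ring.lie_def, hmul _ _ (by omega) (by omega), hmul _ _ hk (by omega)]

theorem neg_mul_sub_mul_neg {R : Type*} [Ring R] (a b : R) :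
    -a * b - b * -a = -(a * b - b * a) := by
  noncomm_ring

theorem linearMap_ext_T {f g : Module.End ℂ (H n i i' top)}
    (h : ∀ L ∈ basisTableaux n i i' top, f (T n i i' top L) = g (T n i i' top L)) : f = g := by
  refine Finsupp.lhom_ext' fun L => LinearMap.ext_ring ?_
  have hTL : T n i i' top L.1 = Finsupp.single L 1 := dif_pos L.2
  simp only [LinearMap.comp_apply, Finsupp.lsingle_apply]
  rw [← hTL]
  exact h L L.2

/-- If the Gelfand-Tsetlin formulas define a module, the residues at the double poles cancel. -/
theorem DefinesModule.sum_residue_eq_zero (hi : IsIndexSystem n i i') (htop : StrictAnti top)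
    (hM : DefinesModule n i i' top) (hL : L ∈ basisTableaux n i i' top) (hk : 1 ≤ k)
    (hkn : k ≤ n - 1) : ∑ x ∈ adjSet k L, residue k L x = 0 := by
  obtain ⟨ρ, h1, h2, h3⟩ := hM
  have e1 : ρ (E n k (k + 1)) = -trunc (basisTableaux n i i' top) (stepOp 1 k (k + 1)) := by
    refine linearMap_ext_T fun L hL => ?_
    rw [h1 L hL k hk hkn, LinearMap.neg_apply, trunc_stepOp_apply_T 1 k (k + 1) hL,
      ← Finset.sum_neg_distrib]
    refine Finset.sum_congr rfl fun r _ => ?_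
    rw [eCoeff_eq, neg_smul, shift, one_smul]
  have e2 : ρ (E n (k + 1) k) = trunc (basisTableaux n i i' top) (stepOp (-1) k (k - 1)) := by
    refine linearMap_ext_T fun L hL => ?_
    rw [h2 L hL k hk hkn, trunc_stepOp_apply_T (-1) k (k - 1) hL]
    refine Finset.sum_congr rfl fun r _ => ?_
    rw [fCoeff_eq, shift, neg_one_smul, sub_eq_add_neg]
  have key : ρ (E n k k) - ρ (E n (k + 1) (k + 1)) =
      -trunc (basisTableaux n i i' top) (diagOp fun L =>
        ∑ x ∈ adjSet k L, residue k L x - (weight k L - weight (k + 1) L)) := by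
    have e3 : ρ (E n k k) - ρ (E n (k + 1) (k + 1)) =
        ρ (E n k (k + 1)) * ρ (E n (k + 1) k) - ρ (E n (k + 1) k) * ρ (E n k (k + 1)) := by
      refine ((ρ : Matrix (Fin n) (Fin n) ℂ →ₗ[ℂ] Module.End ℂ (H n i i' top)).map_sub _ _).symm.trans ?_
      rw [← E_lie_E hk (by omega)]
      exact ρ.map_lie _ _
    rw [← commutator_row hi htop hk hkn, e3, e1, e2]
    exact neg_mul_sub_mul_neg (R := Module.End ℂ (basisTableaux n i i' top →₀ ℂ)) _ _
  -- Compare the diagonal matrix coefficients at `L`.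
  have h4 := congrArg (fun A => A (T n i i' top L) ⟨L, hL⟩) key
  simp only [LinearMap.sub_apply, LinearMap.neg_apply] at h4
  have hTL : T n i i' top L ⟨L, hL⟩ = 1 := by rw [T, dif_pos hL]; simp
  rw [h3 L hL k hk (by omega), h3 L hL (k + 1) (by omega) (by omega),
    trunc_diagOp_apply_T _ hL, Finsupp.sub_apply, Finsupp.neg_apply, Finsupp.smul_apply,
    Finsupp.smul_apply, Finsupp.smul_apply, hTL] at h4
  simp only [smul_eq_mul, mul_one] at h4
  linear_combination h4

/-- The rows of a tableau, from the top, if every row is computed from the row above. -/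
def fillRow (n : ℕ) (top : Fin n → ℤ) (p : ℕ → (ℕ → ℤ) → ℕ → ℤ) : ℕ → ℕ → ℤ
  | 0 => fun j => if h : 1 ≤ j ∧ j ≤ n then top ⟨j - 1, by omega⟩ else 0
  | d + 1 => fun j =>
    if 1 ≤ j ∧ j ≤ n - 1 - d then p (n - 1 - d) (fillRow n top p d) j else 0

/-- The tableau with the given top row in which every row is computed from the row above. -/
def fill (n : ℕ) (top : Fin n → ℤ) (p : ℕ → (ℕ → ℤ) → ℕ → ℤ) (k j : ℕ) : ℤ :=
  if k ≤ n then fillRow n top p (n - k) j else 0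

theorem fill_apply {p : ℕ → (ℕ → ℤ) → ℕ → ℤ} {k : ℕ} (hk : k + 1 ≤ n) (j : ℕ) :
    fill n top p k j = if 1 ≤ j ∧ j ≤ k then p k (fill n top p (k + 1)) j else 0 := by
  obtain ⟨d, rfl⟩ : ∃ d, n = k + 1 + d := ⟨n - (k + 1), by omega⟩
  have e1 : fill (k + 1 + d) top p (k + 1) = fillRow (k + 1 + d) top p d := by
    funext t
    rw [fill, if_pos (by omega), Nat.add_sub_cancel_left]
  have e2 : k + 1 + d - k = d + 1 := by omega
  have e3 : k + 1 + d - 1 - d = k := by omega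
  rw [e1, fill, if_pos (by omega), e2, fillRow, e3]

theorem fill_congr {p p' : ℕ → (ℕ → ℤ) → ℕ → ℤ} {K : ℕ} (h : ∀ k, K ≤ k → p k = p' k) :
    ∀ k, K ≤ k → fill n top p k = fill n top p' k := by
  suffices H : ∀ d k, K ≤ k → k + d = n → fill n top p k = fill n top p' k by
    intro k hk
    rcases le_or_gt k n with h1 | h1
    · exact H (n - k) k hk (by omega)
    · funext j
      rw [fill, fill, if_neg (by omega), if_neg (by omega)]
  intro d
  induction d with
  | zero =>
    intro k _ h2
    obtain rfl : k = n := by omega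
    funext j
    simp [fill, fillRow]
  | succ d ih =>
    intro k h1 h2
    funext j
    rw [fill_apply (by omega), fill_apply (by omega), ih (k + 1) (by omega) (by omega), h k h1]

/-- Rows are built downwards. A decreasing row yields a decreasing row below it, since slots
increase strictly and an entry of the upper row separates consecutive entries. -/
theorem fill_mem (hi : IsIndexSystem n i i') (htop : StrictAnti top)
    {p : ℕ → (ℕ → ℤ) → ℕ → ℤ}
    (hp : ∀ k, 1 ≤ k → k ≤ n - 1 → ∀ a : ℕ → ℤ, (∀ m, 1 ≤ m → m ≤ k → a (m + 1) < a m) →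
      ∀ j m, 1 ≤ j → j ≤ k → 1 ≤ m → m ≤ k + 1 → (p k a j ≤ a m ↔ m ≤ slot i i' k j)) :
    fill n top p ∈ basisTableaux n i i' top := by
  have htopRow : ∀ j, (_ : 1 ≤ j) → (_ : j ≤ n) → fill n top p n j = top ⟨j - 1, by omega⟩ := by
    intro j j1 j2
    simp [fill, fillRow, j1, j2]
  have anti : ∀ d k, k + d = n → ∀ m, 1 ≤ m → m + 1 ≤ k →
      fill n top p k (m + 1) < fill n top p k m := by
    intro d
    induction d with
    | zero =>
      intro k hk m m1 m2
      obtain rfl : k = n := by omega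
      rw [htopRow m m1 (by omega), htopRow (m + 1) (by omega) m2]
      exact htop (by simp only [Fin.lt_def]; omega)
    | succ d ih =>
      intro k hk m m1 m2
      have a1 := ih (k + 1) (by omega)
      have hik := hi k (by omega) (by omega)
      have s1 := slot_lt (i := i) (i' := i') m1 hik.2.2.2
      have s2 := slot_le (i := i) (i' := i') k (m + 1) m2
      rw [fill_apply (by omega), fill_apply (by omega), if_pos (by omega), if_pos (by omega)]
      have v := hp k (by omega) (by omega) (fill n top p (k + 1))
        (fun m m1 m2 => a1 m m1 (by omega))
      have v1 := v (m + 1) (slot i i' k (m + 1)) (by omega) m2 (by omega) s2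
      have v2 := v m (slot i i' k (m + 1)) m1 (by omega) (by omega) s2
      omega
  rw [mem_basisTableaux_iff hi htop]
  refine ⟨fun k j hkj => ?_, fun j => ?_, fun k j m k1 k2 j1 j2 m1 m2 => ?_⟩
  · rcases lt_trichotomy k n with h | rfl | h
    · rw [fill_apply (by omega), if_neg (by omega)]
    · have : ¬ (1 ≤ j ∧ j ≤ k) := by omega
      simp [fill, fillRow, this]
    · rw [fill, if_neg (by omega)]
  · rw [htopRow (j.val + 1) (by omega) (by omega)]
    simp
  · rw [fill_apply (by omega), if_pos ⟨j1, j2⟩]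
    exact hp k k1 k2 _ (fun m m1 m2 => anti (n - (k + 1)) (k + 1) (by omega) m m1 (by omega))
      j m j1 j2 m1 m2

/-- Every entry is the largest possible one, except that the entry `(K, s)` is the smallest
possible one and an unbounded entry of row `K - 1` is increased by `t`. -/
def pick (i i' : ℕ → ℕ) (K s : ℕ) (t : ℕ) (k : ℕ) (a : ℕ → ℤ) (j : ℕ) : ℤ :=
  if k = K ∧ j = s then a (slot i i' k j + 1) + 1
  else if slot i i' k j = 0 then a 1 + 1 + (if k + 1 = K then (t : ℤ) else 0)
  else a (slot i i' k j)

/-- Every chosen value lies in the interval of its slot. For the entry `(K, s)` the bound from below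
exists because `s < K`. -/
theorem pick_le_iff {K s t : ℕ} (hsK : s < K) (hi : i K < i' K) (hs' : s + 1 ≠ i' K) {k : ℕ}
    {a : ℕ → ℤ} (ha : ∀ m, 1 ≤ m → m ≤ k → a (m + 1) < a m) {j m : ℕ} (hj : 1 ≤ j) (hjk : j ≤ k)
    (hm : 1 ≤ m) (hmk : m ≤ k + 1) : pick i i' K s t k a j ≤ a m ↔ m ≤ slot i i' k j := by
  have anti : ∀ m m', 1 ≤ m → m < m' → m' ≤ k + 1 → a m' < a m := by
    intro m m' m1 hmm
    induction m', (Nat.succ_le_of_lt hmm) using Nat.le_induction with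
    | base => intro h; exact ha m m1 (by omega)
    | succ m' h2 ih =>
      intro h
      exact (ha m' (by omega) (by omega)).trans (ih (by omega) (by omega))
  have anti' : ∀ m m', 1 ≤ m → m ≤ m' → m' ≤ k + 1 → a m' ≤ a m := by
    intro m m' m1 hmm h
    rcases hmm.lt_or_eq with hmm | rfl
    · exact (anti m m' m1 hmm h).le
    · exact le_rfl
  have hc := slot_le (i := i) (i' := i') k j hjk
  rw [pick]
  set c := slot i i' k j with hcdef
  split_ifs with h1 h2 h3
  · have hc' : c + 1 ≤ k + 1 := by
      obtain ⟨rfl, rfl⟩ := h1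
      rw [hcdef]; unfold slot; split_ifs <;> omega
    constructor
    · intro h
      by_contra hcm
      have := anti' (c + 1) m (by omega) (by omega) hmk
      omega
    · intro h
      have := anti m (c + 1) hm (by omega) hc'
      omega
  · have := anti' 1 m le_rfl hm hmk
    constructor
    · intro h; omega
    · intro h; omega
  · have := anti' 1 m le_rfl hm hmk
    constructor
    · intro h; omega
    · intro h; omega
  · constructor
    · intro h
      by_contra hcm
      have := anti c m (by omega) (by omega) hmk
      omega
    · intro h
      exact anti' m c hm h hc

/-- If an entry of row `k + 1` has no entry of row `k` in the interval below it, its value does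
not occur in row `k`. -/
theorem ne_of_slot_empty (hi : IsIndexSystem n i i') (htop : StrictAnti top)
    (hL : L ∈ basisTableaux n i i' top) (hk : 1 ≤ k) (hkn : k ≤ n - 1) {s : ℕ} (hs : 1 ≤ s)
    (hsk : s ≤ k) (hs' : s = i k ∨ s = i' k) {t : ℕ} (h1 : 1 ≤ t) (h2 : t ≤ k) :
    L (k + 1) s ≠ L k t := by
  intro h
  have hC := ((mem_basisTableaux_iff hi htop).1 hL).2.2
  have a1 := hC k t s hk hkn h1 h2 hs (by omega)
  have a2 := hC k t (s + 1) hk hkn h1 h2 (by omega) (by omega)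
  have a3 := hL.2.2.row_lt hi (k + 1) s (by omega) (by omega) hs (by omega)
  have := slot_ne (i := i) (i' := i') h1 (hi k hk hkn).2.2.2
  omega

/-- The part of the residue in row `k` that does not depend on the rows below. -/
noncomputable def residueFactor (k : ℕ) (L : ℕ → ℕ → ℤ) (x : ℤ) : ℂ :=
  (∏ y ∈ rowSet (k + 1) L \ adjSet k L, ((x : ℂ) - (y : ℂ))) /
      ∏ y ∈ (poleSet k L).erase x, ((x : ℂ) - (y : ℂ))

theorem residueFactor_ne_zero {x : ℤ} (hx : x ∈ adjSet k L) : residueFactor k L x ≠ 0 := by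
  refine div_ne_zero (Finset.prod_ne_zero_iff.2 fun y hy => ?_)
    (Finset.prod_ne_zero_iff.2 fun y hy => ?_)
  · rw [sub_ne_zero, Ne, Int.cast_inj]
    rintro rfl
    exact (Finset.mem_sdiff.1 hy).2 hx
  · rw [sub_ne_zero, Ne, Int.cast_inj]
    rintro rfl
    exact (Finset.mem_erase.1 hy).1 rfl

/-- Separates the dependence on row `k - 1`, so that this row can be varied with the rows above
fixed. -/
theorem residue_eq_mul_link (h : Set.InjOn (L (k - 1)) (Finset.Icc 1 (k - 1))) (x : ℤ) :
    residue k L x = residueFactor k L x * link (Finset.Icc 1 (k - 1)) (L (k - 1)) (x + 1) := by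
  rw [link_eq_prod_rowSet h, residue, residueFactor]
  push_cast
  ring

theorem residueFactor_congr {L' : ℕ → ℕ → ℤ} (h1 : L k = L' k) (h2 : L (k + 1) = L' (k + 1))
    (x : ℤ) : residueFactor k L x = residueFactor k L' x := by
  have e1 : rowSet k L = rowSet k L' := by rw [rowSet, rowSet, h1]
  have e2 : rowSet (k + 1) L = rowSet (k + 1) L' := by rw [rowSet, rowSet, h2]
  have e3 : adjSet k L = adjSet k L' := by rw [adjSet, adjSet, e1]
  have e4 : poleSet k L = poleSet k L' := by rw [poleSet, poleSet, e1]
  rw [residueFactor, residueFactor, e2, e3, e4]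

/-- A slot of row `K - 1` without an entry, between two positions of row `K` that can be
adjacent, contradicts the commutation relation in row `K`. -/
theorem DefinesModule.false_of_slot_empty (hi : IsIndexSystem n i i') (htop : StrictAnti top)
    (hM : DefinesModule n i i' top) {K s : ℕ} (hKn : K + 1 ≤ n - 1) (hs : 1 ≤ s) (hsK : s ≤ K)
    (h1 : s ≠ i (K + 1)) (h2 : s + 1 ≠ i' (K + 1)) (hs' : s = i K ∨ s = i' K) : False := by
  have hiK := hi (K + 1) (by omega) hKn
  have hiK' := hi K (by omega) (by omega)
  set L : ℕ → ℕ → ℕ → ℤ := fun t => fill n top (pick i i' (K + 1) s t) with hLdef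
  have hL : ∀ t, L t ∈ basisTableaux n i i' top := fun t =>
    fill_mem hi htop fun k k1 k2 a ha j m j1 j2 m1 m2 =>
      pick_le_iff (by omega) hiK.2.2.2 h2 ha j1 j2 m1 m2
  have hupper : ∀ t k, K + 1 ≤ k → L t k = L 0 k := fun t =>
    fill_congr fun k hk => by
      funext a j
      simp only [pick, if_neg (show k + 1 ≠ K + 1 by omega)]
  have hadj : L 0 (K + 1) s = L 0 (K + 1) (s + 1) + 1 := by
    have e1 := slot_succ (i := i) (i' := i') hs hiK.2.2.2 h1 h2
    simp only [hLdef]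
    rw [fill_apply (by omega), fill_apply (by omega), if_pos (by omega), if_pos (by omega), pick,
      pick, if_pos ⟨rfl, rfl⟩, if_neg (by omega), if_neg (by omega), e1]
  have hinj : ∀ t, Set.InjOn (L t K) (Finset.Icc 1 K) := fun t => injOn_row hi (hL t) (by omega)
  have hsum := fun t => hM.sum_residue_eq_zero hi htop (hL t) (k := K + 1) (by omega) hKn
  set x := L 0 (K + 1) (s + 1) with hx
  have hxD : x ∈ adjSet (K + 1) (L 0) := by
    rw [adjSet, Finset.mem_filter, mem_rowSet, mem_rowSet]
    exact ⟨⟨s + 1, by omega, by omega, rfl⟩, s, hs, by omega, hadj⟩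
  have hempty : ∀ t, 1 ≤ t → t ≤ K → L 0 (K + 1) s ≠ L 0 K t := fun t t1 t2 =>
    ne_of_slot_empty hi htop (hL 0) (by omega) (by omega) hs hsK hs' t1 t2
  -- If `i K = 0`, then `s = i' K` is the only empty interval that can matter: all other double
  -- poles have zero residue, and the one at `x` does not.
  rcases Nat.eq_zero_or_pos (i K) with hi0 | hi0
  · refine residueFactor_ne_zero hxD ?_
    have h0 := hsum 0
    rw [Finset.sum_eq_single x, residue_eq_mul_link (hinj 0)] at h0
    · refine (mul_eq_zero.1 h0).resolve_right (link_ne_zero fun t ht => ?_)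
      rw [Finset.mem_Icc] at ht
      rw [← hadj]
      exact hempty t ht.1 ht.2
    · intro y hy hyx
      obtain ⟨j, j1, j2, e1, e2⟩ := exists_of_mem_adjSet hi (hL 0) (by omega) hy
      have hjs : j ≠ s := by rintro rfl; exact hyx e1.symm
      obtain ⟨t, t1, t2, ht⟩ := exists_lower_of_adjacent hi htop (hL 0) (k := K) (j := j)
        (by omega) j1 (by omega) (by omega) (by omega) (by omega)
      exact residue_eq_zero t1 t2 (ht.trans e2)
    · exact fun h => absurd hxD h
  · have h1K : 1 ∈ Finset.Icc 1 K := Finset.mem_Icc.2 ⟨le_rfl, by omega⟩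
    have hfirst : ∀ t, L t K 1 = L 0 (K + 1) 1 + 1 + t := by
      intro t
      have e0 := hupper t (K + 1) le_rfl
      simp only [hLdef] at e0 ⊢
      rw [fill_apply (by omega), if_pos (by omega), pick, if_neg (by omega), if_pos, if_pos rfl, e0]
      unfold slot; rw [if_pos (by omega)]
    have hother : ∀ t j, j ≠ 1 → L t K j = L 0 K j := by
      intro t j hj
      have e0 := hupper t (K + 1) le_rfl
      simp only [hLdef] at e0 ⊢
      rw [fill_apply (by omega), fill_apply (by omega), e0]
      split_ifs with hjK
      · have hne : slot i i' K j ≠ 0 := by unfold slot; split_ifs <;> omega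
        rw [pick, if_neg (by omega), if_neg hne, pick, if_neg (by omega), if_neg hne]
      · rfl
    -- For `i K > 0` the entry `(K, 1)` is unbounded above, and each residue is affine in its
    -- displacement `t`, with `C` independent of `t`.
    set C : ℤ → ℂ := fun y => residueFactor (K + 1) (L 0) y *
      link ((Finset.Icc 1 K).erase 1) (L 0 K) (y + 1) with hC
    have hres : ∀ t y, residue (K + 1) (L t) y = C y * ((y : ℂ) - L 0 (K + 1) 1 - t) := by
      intro t y
      rw [residue_eq_mul_link (hinj t), Nat.add_sub_cancel, link_erase h1K, hfirst,
        residueFactor_congr (hupper t _ le_rfl) (hupper t _ (by omega)),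
        link_congr (b := L 0 K) fun m hm => hother t m (Finset.ne_of_mem_erase hm), hC]
      push_cast
      ring
    have hD : ∀ t, adjSet (K + 1) (L t) = adjSet (K + 1) (L 0) := by
      intro t
      rw [adjSet, adjSet, rowSet, rowSet, hupper t (K + 1) le_rfl]
    have h0 := hsum 0
    have h1 := hsum 1
    rw [Finset.sum_congr rfl fun y _ => hres _ y, hD] at h0 h1
    -- `e` is the other empty interval; positions `e`, `e + 1` of row `K + 1` may also be adjacent
    -- and contribute a residue.
    obtain ⟨e, he, he1, he2, hes⟩ : ∃ e, (e = i K ∨ e = i' K) ∧ 1 ≤ e ∧ e ≤ K + 1 ∧ e ≠ s ∧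
        ∀ j, j ≠ s → j ≠ e → j ≠ i K ∧ j ≠ i' K := by
      rcases hs' with hs' | hs'
      · exact ⟨i' K, Or.inr rfl, by omega, by omega, by omega, fun j _ _ => by omega⟩
      · exact ⟨i K, Or.inl rfl, by omega, by omega, by omega, fun j _ _ => by omega⟩
    -- The cases `t = 0` and `t = 1` span all affine weights in `y`; this one vanishes at the double
    -- pole belonging to `e` and leaves only the nonzero term at `x`.
    have h3 : ∑ y ∈ adjSet (K + 1) (L 0), C y * ((y : ℂ) + 1 - L 0 (K + 1) e) = 0 := by
      have e1 : ∀ y : ℤ, C y * ((y : ℂ) + 1 - L 0 (K + 1) e) =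
          C y * ((y : ℂ) - L 0 (K + 1) 1 - (0 : ℕ)) + (1 - L 0 (K + 1) e + L 0 (K + 1) 1) *
            (C y * ((y : ℂ) - L 0 (K + 1) 1 - (0 : ℕ)) -
              C y * ((y : ℂ) - L 0 (K + 1) 1 - (1 : ℕ))) := by
        intro y; push_cast; ring
      rw [Finset.sum_congr rfl fun y _ => e1 y, Finset.sum_add_distrib, ← Finset.mul_sum,
        Finset.sum_sub_distrib, h0, h1]
      ring
    rw [Finset.sum_eq_single x] at h3
    · refine mul_ne_zero (mul_ne_zero (residueFactor_ne_zero hxD) (link_ne_zero fun t ht => ?_))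
        ?_ h3
      · rw [← hadj]
        have ht' := Finset.mem_Icc.1 (Finset.mem_of_mem_erase ht)
        exact hempty t ht'.1 ht'.2
      · have e2 : L 0 (K + 1) s ≠ L 0 (K + 1) e := fun h =>
          hes.1 (injOn_row hi (hL 0) (by omega) (by simp; omega) (by simp; omega) h.symm)
        rw [hadj] at e2
        rw [sub_ne_zero]
        exact_mod_cast e2
    · intro y hy hyx
      obtain ⟨j, j1, j2, e1, e2⟩ := exists_of_mem_adjSet hi (hL 0) (by omega) hy
      have hjs : j ≠ s := by rintro rfl; exact hyx e1.symm
      by_cases hje : j = e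
      · rw [← hje, e2]
        push_cast
        ring
      · obtain ⟨hj1, hj2⟩ := hes.2 j hjs hje
        obtain ⟨t, t1, t2, ht⟩ := exists_lower_of_adjacent hi htop (hL 0) (k := K) (j := j)
          (by omega) j1 (by omega) (by omega) hj1 hj2
        -- The link in `C` omits the entry `(K, 1)`, so the zero must come from another one; the
        -- first entry exceeds all of row `K + 1`.
        have ht1 : t ≠ 1 := by
          rintro rfl
          rw [hfirst 0] at ht
          have : L 0 (K + 1) j ≤ L 0 (K + 1) 1 := by
            rcases j1.lt_or_eq with h | h
            · exact ((hL 0).2.2.row_anti hi (by omega) (by omega) le_rfl h (by omega)).le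
            · rw [← h]
          push_cast at ht
          omega
        simp only [hC]
        rw [← e2, ← ht, link_eq_zero (Finset.mem_erase.2 ⟨ht1, Finset.mem_Icc.2 ⟨t1, t2⟩⟩)]
        ring
    · exact fun h => absurd hxD h

/-- The Lemire-Patera condition is necessary. -/
theorem DefinesModule.lemirePatera (hi : IsIndexSystem n i i') (htop : StrictAnti top)
    (hM : DefinesModule n i i' top) : LemirePatera n i i' := by
  intro k k1 k2
  obtain ⟨K, rfl⟩ : ∃ K, k = K + 1 := ⟨k - 1, by omega⟩
  have h1 := hi (K + 1) (by omega) k2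
  have h2 := hi K (by omega) (by omega)
  have key := fun s a b c d => hM.false_of_slot_empty hi htop (K := K) (s := s) k2 a b c d
  simp only [Nat.add_sub_cancel, Set.mem_insert_iff, Set.mem_singleton_iff]
  constructor
  · by_contra h
    exact key (i K) (by omega) (by omega) (by omega) (by omega) (Or.inl rfl)
  · by_contra h
    exact key (i' K) (by omega) (by omega) (by omega) (by omega) (Or.inr rfl)

end Necessity

end GelfandGraev

theorem theoremI (n : ℕ) (hn : 2 ≤ n) (i i' : ℕ → ℕ) (hi : GelfandGraev.IsIndexSystem n i i')
    (top : Fin n → ℤ) (htop : StrictAnti top) :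
    GelfandGraev.DefinesModule n i i' top ↔ GelfandGraev.LemirePatera n i i' :=
  ⟨fun h => h.lemirePatera hi htop, fun h => h.definesModule (by omega) hi htop⟩
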